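/- **Setting.** Let $f:\mathbb R^d\to\mathbb R$ ($d\ge1$) be $L_0$-Lipschitz and $L_1$-smooth (differentiable with $L_1$-Lipschitz gradient), with finite optimal value $f^\ast=\inf f$, and suppose $\sup_x\mathbb E_u|f(x+tu)|<\infty$ for every $t\in[0,t_1]$, where $u\sim\mathcal N(0,I_d)$, and $L_0,L_1,t_1>0$ (so $f$ is bounded). Only a (Borel) function $f'$ with $\sup_x|f(x)-f'(x)|\le\nu$ is accessible; $f'$ may be discontinuous. Put $F'(x,t)=\mathbb E_u[f'(x+tu)]$. **Algorithm** (deterministic ZOSLGH with error tolerance). Let $\gamma\in(0,1)$, $\eta\in\mathbb R$, and let $u_k,v_k\sim\mathcal N(0,I_d)$, $k\ge1$, be independent. From an initial pair $(x_1,t_1)$ iterate $$x_{k+1}=x_k-\beta_k\,\frac{f'(x_k+t_ku_k)-f'(x_k)}{t_k}\,u_k,\qquad \beta_k=\frac1{16(d+4)L_1(t_k)},$$ and either $t_{k+1}=\max\{\gamma t_k,\sqrt\nu\}$ (ratio rule) or, with $\nu>0$, $t_{k+1}=\max\{\min\{t_k-\eta\,\tilde g_t,\gamma t_k\},\sqrt\nu\}$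 with $\tilde g_t=(v_k^\top v_k-d)\,(f'(x_k+t_kv_k)-f'(x_k))/t_k^2$ (derivative rule). Here $L_1(t)$ is a gradient Lipschitz constant of $F'(\cdot,t)$: any measurable function such that, for all $0<t\le\max\{t_1,\sqrt\nu\}$, $F'(\cdot,t)$ is $L_1(t)$-smooth and $\ell\le L_1(t)\le L_1+2\nu/t^2$, for a constant $\ell>0$. **Theorem.** For every $t>0$, $F'(\cdot,t)$ is $(L_1+2\nu/t^2)$-smooth, so that $L_1(t)=L_1+2\nu/t^2$ is always an allowed choice (with $\ell=L_1$). Moreover, fix $\bar\gamma<1$, $\ell>0$, $a>0$ and $A,B\in\mathbb R$. There are a constant $c>0$ and functions $C_1(\cdot)$, $C_2(\cdot,\cdot)$, depending only on $L_0,L_1,t_1,\bar\gamma,\ell,a,A,B$, such that the following holds for all $d\ge 1$, all $f,f',\nu,x_1$ as above, all $\eta$, all $\epsilon>0$ and all $0<\gamma\le\bar\gamma$, provided $\nu\le c\,\epsilon^2/d^3$. Let $k_1,k_2\in\mathbb N$ with $a\,d/\epsilon^2\le k_1\le A\,d/\epsilon^2$ and $k_2\le B\log_\gamma(1/d)+1$,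 put $k_0=\min\{k_1,k_2\}$, and let $\hat x=x_{k'}$ with $k'$ uniform on $\{k_0+1,\dots,T\}$ and independent of all $u_k,v_k$. 1. For any $\Delta\ge f(x_1)-f^\ast$ and every integer $T\ge C_1(\Delta)\,d^3/\epsilon^2$, one has $T>k_0$ and $\mathbb E\|\nabla f(\hat x)\|\le\epsilon$. That is, the iteration complexity is $T=O(d^3/\epsilon^2)$. 2. For any $M\ge\sup_x f(x)-f^\ast$ and $\omega>0$, if $\gamma\le d^{-\omega\epsilon^2/d}$, then for every integer $T\ge C_2(M,\omega)\,d/\epsilon^2$ one has $T>k_0$ and $\mathbb E\|\nabla f(\hat x)\|\le\epsilon$. That is, the iteration complexity is $T=O(d/\epsilon^2)$. The expectation is over $u_k,v_k$ and $k'$. -/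

import Mathlib

open MeasureTheory ProbabilityTheory

universe w

/-- A function `h : ℝᵈ → ℝ` is `K`-smooth: it is differentiable and its gradient is
`K`-Lipschitz for the Euclidean norm. -/
structure IsSmoothWith {d : ℕ} (K : ℝ) (h : EuclideanSpace ℝ (Fin d) → ℝ) : Prop where
  differentiable : Differentiable ℝ h
  gradient_lipschitz : ∀ x y, ‖gradient h x - gradient h y‖ ≤ K * ‖x - y‖

/-- The Gaussian smoothed function `F(x, t) = 𝔼 f(x + t u)`, `u ∼ N(0, I_d)`, of `f`. -/
noncomputable def gaussianSmoothing {d : ℕ} (f : EuclideanSpace ℝ (Fin d) → ℝ) (t : ℝ)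
    (x : EuclideanSpace ℝ (Fin d)) : ℝ :=
  ∫ u, f (x + t • u) ∂(stdGaussian (EuclideanSpace ℝ (Fin d)))

/-- The standing assumptions on the objective function `f`, with smoothing parameters ranging over
`[0, t₁]`: the expectations `𝔼 |f(x + t u)|` are finite and bounded uniformly in `x`, the problem
of minimizing `f` has the (finite) optimal value `fstar`, and `f` is `L₀`-Lipschitz and
`L₁`-smooth. -/
structure ObjectiveAssumptions {d : ℕ} (f : EuclideanSpace ℝ (Fin d) → ℝ)
    (fstar L₀ L₁ t₁ : ℝ) : Prop where
  integrable : ∀ t ∈ Set.Icc 0 t₁, ∀ x,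
    Integrable (fun u => f (x + t • u)) (stdGaussian (EuclideanSpace ℝ (Fin d)))
  bounded : ∀ t ∈ Set.Icc 0 t₁,
    BddAbove (Set.range fun x => ∫ u, |f (x + t • u)| ∂(stdGaussian (EuclideanSpace ℝ (Fin d))))
  optimal_value : IsGLB (Set.range f) fstar
  lipschitz : ∀ x y, |f x - f y| ≤ L₀ * ‖x - y‖
  smooth : IsSmoothWith L₁ f

/-- The two update rules for the smoothing parameter: the fixed-ratio rule and the derivative
rule. -/
inductive SmoothingRule
  | ratio
  | derivative

/-- The zeroth-order estimator `(f'(x + t u) - f'(x)) u / t` of the gradient in `x` of the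
Gaussian smoothing of `f'`. -/
noncomputable def zoGradient {d : ℕ} (f' : EuclideanSpace ℝ (Fin d) → ℝ)
    (x : EuclideanSpace ℝ (Fin d)) (t : ℝ) (u : EuclideanSpace ℝ (Fin d)) :
    EuclideanSpace ℝ (Fin d) :=
  ((f' (x + t • u) - f' x) / t) • u

/-- The zeroth-order estimator `(vᵀv - d)(f'(x + t v) - f'(x)) / t²` of the derivative in `t`. -/
noncomputable def zoDerivative {d : ℕ} (f' : EuclideanSpace ℝ (Fin d) → ℝ)
    (x : EuclideanSpace ℝ (Fin d)) (t : ℝ) (v : EuclideanSpace ℝ (Fin d)) : ℝ :=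
  (‖v‖ ^ 2 - d) * (f' (x + t • v) - f' x) / t ^ 2

/-- The new smoothing parameter computed from the current point `x`, the current smoothing
parameter `t` and the sample `v`; it is never below `√ν`. -/
noncomputable def nextSmoothing {d : ℕ} (rule : SmoothingRule)
    (f' : EuclideanSpace ℝ (Fin d) → ℝ) (η γ ν : ℝ)
    (x : EuclideanSpace ℝ (Fin d)) (t : ℝ) (v : EuclideanSpace ℝ (Fin d)) : ℝ :=
  match rule with
  | .ratio => max (γ * t) (Real.sqrt ν)
  | .derivative => max (min (t - η * zoDerivative f' x t v) (γ * t)) (Real.sqrt ν)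

/-- The iterates `(x_k, t_k)`, `k ≥ 1`, of the zeroth-order single loop Gaussian homotopy algorithm
with error tolerance `ν`, driven by the samples `u_k, v_k`, `k ≥ 1`. The step size for `x` at
iteration `k` is `1 / (16 (d + 4) L(t_k))`. The index `0` is not used (it repeats the initial
point). -/
noncomputable def zoslgh {d : ℕ} (rule : SmoothingRule) (f' : EuclideanSpace ℝ (Fin d) → ℝ)
    (L : ℝ → ℝ) (η γ ν : ℝ) (x₁ : EuclideanSpace ℝ (Fin d)) (t₁ : ℝ)
    (u v : ℕ → EuclideanSpace ℝ (Fin d)) : ℕ → EuclideanSpace ℝ (Fin d) × ℝ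
  | 0 => (x₁, t₁)
  | 1 => (x₁, t₁)
  | k + 2 =>
    let p := zoslgh rule f' L η γ ν x₁ t₁ u v (k + 1)
    (p.1 - (1 / (16 * ((d : ℝ) + 4) * L p.2)) • zoGradient f' p.1 p.2 (u (k + 1)),
      nextSmoothing rule f' η γ ν p.1 p.2 (v (k + 1)))

/-- The random data of a run with output index drawn from `{k₀ + 1, …, T}`: the `u_k` and `v_k` are
independent standard Gaussian vectors, and `κ` is uniform on `{k₀ + 1, …, T}` and independent of
all of them. -/
structure IsRunSampling {d : ℕ} {Ω : Type*} [MeasurableSpace Ω] (P : Measure Ω)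
    (u v : ℕ → Ω → EuclideanSpace ℝ (Fin d)) (κ : Ω → ℕ) (k₀ T : ℕ) : Prop where
  law_u : ∀ k, HasLaw (u k) (stdGaussian (EuclideanSpace ℝ (Fin d))) P
  law_v : ∀ k, HasLaw (v k) (stdGaussian (EuclideanSpace ℝ (Fin d))) P
  indep_uv : iIndepFun (Sum.elim u v : ℕ ⊕ ℕ → Ω → EuclideanSpace ℝ (Fin d)) P
  law_index : HasLaw κ (uniformOn (Set.Icc (k₀ + 1) T)) P
  indep_index : IndepFun κ (fun ω => (fun k => u k ω, fun k => v k ω)) P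

/-- After `T` iterations the random output `x̂ = x_κ`, with `κ` uniform on `{k₀ + 1, …, T}`,
satisfies `𝔼 ‖∇f(x̂)‖ ≤ ε` (including that `{k₀ + 1, …, T}` is nonempty and that the expectation
exists), on whatever probability space the samples live. -/
def OutputIsStationary {d : ℕ} (f f' : EuclideanSpace ℝ (Fin d) → ℝ) (rule : SmoothingRule)
    (L : ℝ → ℝ) (η γ ν : ℝ) (x₁ : EuclideanSpace ℝ (Fin d)) (t₁ ε : ℝ) (k₀ T : ℕ) : Prop :=
  k₀ < T ∧
  ∀ (Ω : Type w) [MeasurableSpace Ω] (P : Measure Ω) [IsProbabilityMeasure P]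
    (u v : ℕ → Ω → EuclideanSpace ℝ (Fin d)) (κ : Ω → ℕ),
    IsRunSampling P u v κ k₀ T →
    Integrable (fun ω => ‖gradient f
      (zoslgh rule f' L η γ ν x₁ t₁ (fun k => u k ω) (fun k => v k ω) (κ ω)).1‖) P ∧
    ∫ ω, ‖gradient f
      (zoslgh rule f' L η γ ν x₁ t₁ (fun k => u k ω) (fun k => v k ω) (κ ω)).1‖ ∂P ≤ ε

/-! The descent argument runs on the smoothed function `F'(·, t)`, but the telescoping is done in
`f`. One stochastic step decreases `F'(·, t)` in mean because that function is smooth and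
`zoGradient` is an unbiased estimator of its gradient. Since `F'(·, t)` differs from `f` by at most
`ν + L₁ t² d`, passing from `f` to `F'` before the step and back after it costs `2ν + 2 L₁ t² d`. No
relation between `F'(·, t_k)` and `F'(·, t_{k+1})` is then needed, so the way `t` shrinks, even at
random, is immaterial.

Smoothness of `F'` (`isSmoothWith_gaussianSmoothing`) comes from splitting `f' = f + g` with `|g| ≤
ν`. The part from `f` inherits `L₁`. The rough part `g` is handled by the Cameron-Martin formula,
which moves the translation from `g` to the Gaussian density; two derivatives cost `2ν / t²`.

For the step (`integral_step_le`) the estimator is written as `(⟪∇f, u⟫ + error) u`. Moments of `u`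
up to order six bound its second moment by `6 d ‖∇f‖²` plus an error term, and the step size of
order `1 / (d L)` absorbs the first of these. As `t ≥ √ν`, the constant `L` is at most `L₁ + 2`, so
each step yields a decrease of order `‖∇f‖² / d` up to an error of order `ν + d² t²`.

Independence turns this into a bound in expectation along the iterates. Because `t_{k+1} ≤ max
(γbar^k t₁) √ν`, the errors `d² t²` sum to a geometric series plus a floor `T d² ν`, which `ν ≤ c ε²
/ d³` makes harmless after multiplication by `d`. From the first iteration on, the series costs `d³`
in the sum of squared gradients, which is the first complexity. For the second, the first `K d`
iterations are instead bounded by `L₀²` each; afterwards `d² γbar^(2Kd) ≤ 1`, the remaining series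
costs `O(d)`, and the bound on `f - fstar` restarts the telescoping. Jensen's inequality passes from
squared norms to norms. -/

open scoped RealInnerProductSpace

/-! ### Exponential moments and translations of the standard Gaussian -/

section StdGaussian

variable {E : Type*} [NormedAddCommGroup E] [InnerProductSpace ℝ E] [FiniteDimensional ℝ E]
  [MeasurableSpace E] [BorelSpace E]

/-- The exponential moments of the standard Gaussian, with complex exponents. -/
lemma integral_cexp_stdGaussian (h s : E) :
    ∫ x, Complex.exp (⟪h, x⟫ + ⟪s, x⟫ * Complex.I) ∂(stdGaussian E) =
      Complex.exp ((‖h‖ ^ 2 - ‖s‖ ^ 2) / 2 + ⟪s, h⟫ * Complex.I) := by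
  obtain ⟨b⟩ : Nonempty (OrthonormalBasis (Fin (Module.finrank ℝ E)) ℝ E) :=
    ⟨stdOrthonormalBasis ℝ E⟩
  have key : ∀ x : Fin (Module.finrank ℝ E) → ℝ,
      Complex.exp (⟪h, ∑ i, x i • b i⟫ + ⟪s, ∑ i, x i • b i⟫ * Complex.I) =
      ∏ i, Complex.exp ((⟪h, b i⟫ + ⟪s, b i⟫ * Complex.I) * x i) := by
    intro x
    rw [← Complex.exp_sum]
    congr 1
    simp only [inner_sum, inner_smul_right]
    push_cast
    rw [Finset.sum_mul, ← Finset.sum_add_distrib]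
    exact Finset.sum_congr rfl fun i _ => by ring
  rw [stdGaussian_eq_map_pi_orthonormalBasis b, integral_map (Measurable.aemeasurable (by fun_prop))
    (Measurable.aestronglyMeasurable (by fun_prop))]
  simp_rw [key]
  rw [integral_fintype_prod_eq_prod (f := fun i (x : ℝ) ↦
    Complex.exp ((⟪h, b i⟫ + ⟪s, b i⟫ * Complex.I) * x))]
  have hz : ∀ z : ℂ, ∫ x : ℝ, Complex.exp (z * x) ∂(gaussianReal 0 1) = Complex.exp (z ^ 2 / 2) := by
    intro z
    have := complexMGF_id_gaussianReal (μ := 0) (v := 1) z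
    simpa [complexMGF] using this
  simp_rw [hz]
  rw [← Complex.exp_sum]
  congr 1
  have e1 := b.sum_sq_inner_left h
  have e2 := b.sum_sq_inner_left s
  have e3 := b.sum_inner_mul_inner s h
  rw [← Complex.ofReal_pow ‖h‖, ← Complex.ofReal_pow ‖s‖, ← e1, ← e2, ← e3]
  push_cast
  rw [← Finset.sum_sub_distrib, Finset.sum_div, Finset.sum_mul, ← Finset.sum_add_distrib]
  refine Finset.sum_congr rfl fun i _ => ?_
  rw [real_inner_comm (b i) h]
  linear_combination (⟪s, b i⟫ : ℂ) ^ 2 / 2 * Complex.I_sq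

/-- Fernique's theorem makes some `exp (C ‖u‖²)` integrable, and completing the square gives `c ‖u‖
≤ c² / (4C) + C ‖u‖²`. This is the dominating function for differentiation under the integral. -/
lemma integrable_exp_mul_norm_stdGaussian (c : ℝ) :
    Integrable (fun u : E => Real.exp (c * ‖u‖)) (stdGaussian E) := by
  obtain ⟨C, hC, hint⟩ := IsGaussian.exists_integrable_exp_sq (stdGaussian E)
  refine (hint.const_mul (Real.exp (c ^ 2 / (4 * C)))).mono'
    (Measurable.aestronglyMeasurable (by fun_prop)) (ae_of_all _ fun u => ?_)
  rw [Real.norm_of_nonneg (Real.exp_pos _).le, ← Real.exp_add]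
  refine Real.exp_le_exp.2 ?_
  have : c ^ 2 / (4 * C) + C * ‖u‖ ^ 2 - c * ‖u‖ = (c - 2 * C * ‖u‖) ^ 2 / (4 * C) := by
    field_simp; ring
  have h2 : 0 ≤ (c - 2 * C * ‖u‖) ^ 2 / (4 * C) := by positivity
  linarith

lemma integrable_exp_inner_stdGaussian (h : E) :
    Integrable (fun u : E => Real.exp ⟪h, u⟫) (stdGaussian E) := by
  refine (integrable_exp_mul_norm_stdGaussian (E := E) ‖h‖).mono'
    (Measurable.aestronglyMeasurable (by fun_prop)) (ae_of_all _ fun u => ?_)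
  rw [Real.norm_of_nonneg (Real.exp_pos _).le]
  exact Real.exp_le_exp.2 (real_inner_le_norm _ _)

/-- The **Cameron-Martin formula** for the standard Gaussian measure. -/
lemma stdGaussian_map_add (h : E) :
    (stdGaussian E).map (fun u => u + h) =
      (stdGaussian E).withDensity (fun u => ENNReal.ofReal (Real.exp (⟪h, u⟫ - ‖h‖ ^ 2 / 2))) := by
  have hint : Integrable (fun u : E => Real.exp (⟪h, u⟫ - ‖h‖ ^ 2 / 2)) (stdGaussian E) := by
    simp_rw [Real.exp_sub]
    exact (integrable_exp_inner_stdGaussian h).div_const _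
  have : IsFiniteMeasure ((stdGaussian E).withDensity
      (fun u => ENNReal.ofReal (Real.exp (⟪h, u⟫ - ‖h‖ ^ 2 / 2)))) :=
    isFiniteMeasure_withDensity_ofReal hint.2
  have : IsFiniteMeasure ((stdGaussian E).map (fun u => u + h)) := by
    infer_instance
  -- Both characteristic functions are values of `integral_cexp_stdGaussian`: at `h = 0` on the
  -- left, and with the real exponent `h` on the right.
  apply Measure.ext_of_charFun
  ext s
  rw [charFun_apply, charFun_apply, integral_map (by fun_prop) (by fun_prop),
    integral_withDensity_eq_integral_toReal_smul (by fun_prop) (by simp)]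
  have e1 : ∀ u : E, Complex.exp (⟪u + h, s⟫ * Complex.I) =
      Complex.exp (⟪s, h⟫ * Complex.I) * Complex.exp (⟪(0 : E), u⟫ + ⟪s, u⟫ * Complex.I) := by
    intro u
    rw [← Complex.exp_add, inner_add_left, real_inner_comm s u, real_inner_comm s h]
    congr 1
    simp
    ring
  have e2 : ∀ u : E, (ENNReal.ofReal (Real.exp (⟪h, u⟫ - ‖h‖ ^ 2 / 2))).toReal •
      Complex.exp (⟪u, s⟫ * Complex.I) =
      Complex.exp (-(‖h‖ ^ 2 / 2)) * Complex.exp (⟪h, u⟫ + ⟪s, u⟫ * Complex.I) := by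
    intro u
    rw [ENNReal.toReal_ofReal (Real.exp_pos _).le, Complex.real_smul, Complex.ofReal_exp,
      ← Complex.exp_add, ← Complex.exp_add, real_inner_comm s u]
    congr 1
    push_cast
    ring
  simp_rw [e1, e2]
  rw [integral_const_mul, integral_const_mul, integral_cexp_stdGaussian, integral_cexp_stdGaussian,
    ← Complex.exp_add, ← Complex.exp_add]
  congr 1
  simp
  ring

lemma integral_comp_add_stdGaussian {F : Type*} [NormedAddCommGroup F] [NormedSpace ℝ F]
    {ψ : E → F} (hψ : StronglyMeasurable ψ) (h : E) :
    ∫ u, ψ (u + h) ∂(stdGaussian E) =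
      ∫ u, Real.exp (⟪h, u⟫ - ‖h‖ ^ 2 / 2) • ψ u ∂(stdGaussian E) := by
  rw [← integral_map (φ := fun u => u + h) (by fun_prop) hψ.aestronglyMeasurable,
    stdGaussian_map_add, integral_withDensity_eq_integral_toReal_smul (by fun_prop) (by simp)]
  simp_rw [ENNReal.toReal_ofReal (Real.exp_pos _).le]

lemma integrable_norm_pow_stdGaussian (n : ℕ) :
    Integrable (fun u : E => ‖u‖ ^ n) (stdGaussian E) := by
  have := (IsGaussian.memLp_id (stdGaussian E) (n : ENNReal) (by simp)).integrable_norm_pow'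
  simpa using this

lemma map_inner_stdGaussian (a : E) :
    (stdGaussian E).map (fun u => ⟪a, u⟫) = gaussianReal 0 (‖a‖₊ ^ 2) := by
  have := IsGaussian.map_eq_gaussianReal (μ := stdGaussian E) (innerSL ℝ a)
  simp only [integral_strongDual_stdGaussian, variance_dual_stdGaussian, innerSL_apply_norm] at this
  rw [show ‖a‖₊ ^ 2 = (‖a‖ ^ 2).toNNReal by
    rw [Real.toNNReal_pow (norm_nonneg a), norm_toNNReal], ← this]
  rfl

end StdGaussian

/-! ### Polynomial moments of the standard Gaussian -/

section Moments

/-- Derivatives of the moment generating function stay of the form polynomial times `exp (v t² /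
2)`, so the moments follow from a recursion on the polynomial. -/
lemma deriv_mul_exp_sq_div_two (v : ℝ) {p q : ℝ → ℝ} (hp : ∀ t, HasDerivAt p (q t) t) :
    deriv (fun t => p t * Real.exp (v * t ^ 2 / 2)) =
      fun t => (q t + v * t * p t) * Real.exp (v * t ^ 2 / 2) := by
  funext t
  have h1 : HasDerivAt (fun t => v * t ^ 2 / 2) (v * t) t := by
    have := ((hasDerivAt_pow 2 t).const_mul v).div_const 2
    exact this.congr_deriv (by push_cast; ring)
  have := (hp t).fun_mul h1.exp
  rw [this.deriv]
  ring

lemma integral_pow_gaussianReal (v : NNReal) (n : ℕ) :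
    ∫ x, x ^ n ∂(gaussianReal 0 v) =
      iteratedDeriv n (fun t => Real.exp ((v : ℝ) * t ^ 2 / 2)) 0 := by
  have h := iteratedDeriv_mgf_zero (X := id) (μ := gaussianReal 0 v) (by simp) n
  rw [mgf_id_gaussianReal] at h
  simp only [zero_mul, zero_add] at h
  rw [h]
  rfl

lemma iteratedDeriv_four_exp_sq_div_two (v : ℝ) :
    iteratedDeriv 4 (fun t => Real.exp (v * t ^ 2 / 2)) = fun t =>
      (v ^ 4 * t ^ 4 + 6 * v ^ 3 * t ^ 2 + 3 * v ^ 2) * Real.exp (v * t ^ 2 / 2) := by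
  have e0 : (fun t => Real.exp (v * t ^ 2 / 2)) = fun t => 1 * Real.exp (v * t ^ 2 / 2) := by simp
  have h2 (t : ℝ) : HasDerivAt (fun t : ℝ => t ^ 2) (2 * t) t := by
    simpa using hasDerivAt_pow 2 t
  have h3 (t : ℝ) : HasDerivAt (fun t : ℝ => t ^ 3) (3 * t ^ 2) t := by
    simpa using hasDerivAt_pow 3 t
  rw [iteratedDeriv_succ, iteratedDeriv_succ, iteratedDeriv_succ, iteratedDeriv_succ,
    iteratedDeriv_zero, e0,
    deriv_mul_exp_sq_div_two v (q := fun _ => 0) (fun t => hasDerivAt_const t 1),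
    deriv_mul_exp_sq_div_two v (p := fun t => 0 + v * t * 1) (q := fun _ => v)
      (fun t => by simpa using (hasDerivAt_id t).const_mul v),
    deriv_mul_exp_sq_div_two v (p := fun t => v + v * t * (0 + v * t * 1))
      (q := fun t => 2 * v ^ 2 * t)
      (fun t => by
        refine (((h2 t).const_mul (v ^ 2)).const_add v).congr_deriv (by ring)
          |>.congr_of_eventuallyEq (Filter.Eventually.of_forall fun t => by ring)),
    deriv_mul_exp_sq_div_two v (q := fun t => 3 * v ^ 2 + 3 * v ^ 3 * t ^ 2)
      (fun t => by
        refine (((hasDerivAt_id t).const_mul (3 * v ^ 2)).add ((h3 t).const_mul (v ^ 3))).congr_deriv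
          (by ring) |>.congr_of_eventuallyEq (Filter.Eventually.of_forall fun t => by
            simp only [Pi.add_apply, id]; ring))]
  funext t
  ring

lemma iteratedDeriv_six_exp_sq_div_two (v : ℝ) :
    iteratedDeriv 6 (fun t => Real.exp (v * t ^ 2 / 2)) 0 = 15 * v ^ 3 := by
  have h2 (t : ℝ) : HasDerivAt (fun t : ℝ => t ^ 2) (2 * t) t := by
    simpa using hasDerivAt_pow 2 t
  have h3 (t : ℝ) : HasDerivAt (fun t : ℝ => t ^ 3) (3 * t ^ 2) t := by
    simpa using hasDerivAt_pow 3 t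
  have h4 (t : ℝ) : HasDerivAt (fun t : ℝ => t ^ 4) (4 * t ^ 3) t := by
    simpa using hasDerivAt_pow 4 t
  have h5 (t : ℝ) : HasDerivAt (fun t : ℝ => t ^ 5) (5 * t ^ 4) t := by
    simpa using hasDerivAt_pow 5 t
  rw [iteratedDeriv_succ, iteratedDeriv_succ, iteratedDeriv_four_exp_sq_div_two,
    deriv_mul_exp_sq_div_two v (q := fun t => v ^ 4 * (4 * t ^ 3) + 6 * v ^ 3 * (2 * t))
      (fun t => (((h4 t).const_mul (v ^ 4)).fun_add
        ((h2 t).const_mul (6 * v ^ 3))).add_const (3 * v ^ 2)),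
    deriv_mul_exp_sq_div_two v
      (q := fun t => v ^ 5 * (5 * t ^ 4) + 10 * v ^ 4 * (3 * t ^ 2) + 15 * v ^ 3)
      (fun t => by
        refine ((((h5 t).const_mul (v ^ 5)).add ((h3 t).const_mul (10 * v ^ 4))).add
          ((hasDerivAt_id t).const_mul (15 * v ^ 3))).congr_deriv
          (by ring) |>.congr_of_eventuallyEq (Filter.Eventually.of_forall fun t => by
            simp only [Pi.add_apply, id]; ring))]
  simp

variable {E : Type*} [NormedAddCommGroup E] [InnerProductSpace ℝ E] [FiniteDimensional ℝ E]
  [MeasurableSpace E] [BorelSpace E]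

lemma integral_inner_pow_stdGaussian (a : E) (n : ℕ) :
    ∫ u, ⟪a, u⟫ ^ n ∂(stdGaussian E) =
      iteratedDeriv n (fun t => Real.exp (‖a‖ ^ 2 * t ^ 2 / 2)) 0 := by
  have := integral_map (μ := stdGaussian E) (φ := fun u => ⟪a, u⟫) (f := fun x : ℝ => x ^ n)
    (by fun_prop) (by fun_prop)
  rw [← this, map_inner_stdGaussian, integral_pow_gaussianReal]
  simp

lemma integral_inner_pow_four_stdGaussian (a : E) :
    ∫ u, ⟪a, u⟫ ^ 4 ∂(stdGaussian E) = 3 * ‖a‖ ^ 4 := by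
  rw [integral_inner_pow_stdGaussian, iteratedDeriv_four_exp_sq_div_two]
  simp
  ring

lemma integral_inner_pow_six_stdGaussian (a : E) :
    ∫ u, ⟪a, u⟫ ^ 6 ∂(stdGaussian E) = 15 * ‖a‖ ^ 6 := by
  rw [integral_inner_pow_stdGaussian, iteratedDeriv_six_exp_sq_div_two]
  ring

lemma integral_inner_mul_inner_stdGaussian (a b : E) :
    ∫ u, ⟪a, u⟫ * ⟪b, u⟫ ∂(stdGaussian E) = ⟪a, b⟫ := by
  have h := covarianceBilin_apply (μ := stdGaussian E) IsGaussian.memLp_two_id a b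
  rw [covarianceBilin_stdGaussian] at h
  simpa [innerSL_apply_apply ℝ] using h.symm

lemma integrable_inner_pow_stdGaussian (a : E) (n : ℕ) :
    Integrable (fun u => ⟪a, u⟫ ^ n) (stdGaussian E) := by
  refine ((integrable_norm_pow_stdGaussian (E := E) n).const_mul (‖a‖ ^ n)).mono'
    (by fun_prop) (ae_of_all _ fun u => ?_)
  rw [norm_pow, ← mul_pow]
  exact pow_le_pow_left₀ (norm_nonneg _) (norm_inner_le_norm _ _) _

variable {d : ℕ}

/-- The power mean inequality for the squared coordinates. It reduces moments of the norm to
one-dimensional ones, with the right power of `d`. -/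
lemma norm_pow_le_sum (n : ℕ) (u : EuclideanSpace ℝ (Fin d)) :
    ‖u‖ ^ (2 * (n + 1)) ≤ (d : ℝ) ^ n * ∑ i, ⟪EuclideanSpace.basisFun (Fin d) ℝ i, u⟫ ^ (2 * (n + 1)) := by
  have h := pow_sum_le_card_mul_sum_pow (s := (Finset.univ : Finset (Fin d)))
    (f := fun i => ⟪EuclideanSpace.basisFun (Fin d) ℝ i, u⟫ ^ 2) (fun i _ => sq_nonneg _) n
  rw [OrthonormalBasis.sum_sq_inner_right] at h
  simp_rw [← pow_mul] at h
  simpa using h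

lemma integral_norm_sq_stdGaussian :
    ∫ u, ‖u‖ ^ 2 ∂(stdGaussian (EuclideanSpace ℝ (Fin d))) = d := by
  simp_rw [← (EuclideanSpace.basisFun (Fin d) ℝ).sum_sq_inner_right]
  rw [integral_finsetSum _ fun i _ => integrable_inner_pow_stdGaussian _ 2]
  simp_rw [sq, integral_inner_mul_inner_stdGaussian]
  simp

lemma integral_norm_pow_four_stdGaussian_le :
    ∫ u, ‖u‖ ^ 4 ∂(stdGaussian (EuclideanSpace ℝ (Fin d))) ≤ 3 * (d : ℝ) ^ 2 := by
  calc _ ≤ ∫ u, (d : ℝ) ^ 1 * ∑ i, ⟪EuclideanSpace.basisFun (Fin d) ℝ i, u⟫ ^ 4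
        ∂(stdGaussian (EuclideanSpace ℝ (Fin d))) :=
        integral_mono (integrable_norm_pow_stdGaussian 4)
          ((integrable_finsetSum _ fun i _ => integrable_inner_pow_stdGaussian _ 4).const_mul _)
          (norm_pow_le_sum 1)
    _ = _ := by
      rw [integral_const_mul, integral_finsetSum _ fun i _ => integrable_inner_pow_stdGaussian _ 4]
      simp_rw [integral_inner_pow_four_stdGaussian]
      simp
      ring

lemma integral_norm_pow_six_stdGaussian_le :
    ∫ u, ‖u‖ ^ 6 ∂(stdGaussian (EuclideanSpace ℝ (Fin d))) ≤ 15 * (d : ℝ) ^ 3 := by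
  calc _ ≤ ∫ u, (d : ℝ) ^ 2 * ∑ i, ⟪EuclideanSpace.basisFun (Fin d) ℝ i, u⟫ ^ 6
        ∂(stdGaussian (EuclideanSpace ℝ (Fin d))) :=
        integral_mono (integrable_norm_pow_stdGaussian 6)
          ((integrable_finsetSum _ fun i _ => integrable_inner_pow_stdGaussian _ 6).const_mul _)
          (norm_pow_le_sum 2)
    _ = _ := by
      rw [integral_const_mul, integral_finsetSum _ fun i _ => integrable_inner_pow_stdGaussian _ 6]
      simp_rw [integral_inner_pow_six_stdGaussian]
      simp
      ring

lemma integrable_inner_sq_mul_norm_sq_stdGaussian (a : E) :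
    Integrable (fun u => ⟪a, u⟫ ^ 2 * ‖u‖ ^ 2) (stdGaussian E) := by
  refine ((integrable_norm_pow_stdGaussian (E := E) 4).const_mul (‖a‖ ^ 2)).mono'
    (by fun_prop) (ae_of_all _ fun u => ?_)
  rw [Real.norm_of_nonneg (by positivity), ← sq_abs]
  calc _ ≤ (‖a‖ * ‖u‖) ^ 2 * ‖u‖ ^ 2 := by gcongr; exact abs_real_inner_le_norm _ _
    _ = _ := by ring

/-- AM-GM, with weights that balance the fourth moments `3 ‖a‖⁴` of `⟪a, u⟫` and `3 d²` of `‖u‖`.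
The growth must be linear in `d`, which a direct Cauchy-Schwarz bound by `‖a‖² ‖u‖⁴` would lose. -/
lemma integral_inner_sq_mul_norm_sq_stdGaussian_le (hd : 1 ≤ d) (a : EuclideanSpace ℝ (Fin d)) :
    ∫ u, ⟪a, u⟫ ^ 2 * ‖u‖ ^ 2 ∂(stdGaussian (EuclideanSpace ℝ (Fin d))) ≤ 3 * d * ‖a‖ ^ 2 := by
  have hd' : (0 : ℝ) < d := by exact_mod_cast hd
  rcases eq_or_ne a 0 with rfl | ha
  · simp
  have ha' : 0 < ‖a‖ := norm_pos_iff.2 ha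
  have h4 := integrable_inner_pow_stdGaussian a 4
  have hn := integrable_norm_pow_stdGaussian (E := EuclideanSpace ℝ (Fin d)) 4
  calc _ ≤ ∫ u, ((d / (2 * ‖a‖ ^ 2)) * ⟪a, u⟫ ^ 4 + (‖a‖ ^ 2 / (2 * d)) * ‖u‖ ^ 4)
        ∂(stdGaussian (EuclideanSpace ℝ (Fin d))) := by
        refine integral_mono (integrable_inner_sq_mul_norm_sq_stdGaussian a)
          ((h4.const_mul _).add (hn.const_mul _)) fun u => ?_
        have : 0 ≤ (d * ⟪a, u⟫ ^ 2 - ‖a‖ ^ 2 * ‖u‖ ^ 2) ^ 2 / (2 * d * ‖a‖ ^ 2) := by positivity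
        have e : (d * ⟪a, u⟫ ^ 2 - ‖a‖ ^ 2 * ‖u‖ ^ 2) ^ 2 / (2 * d * ‖a‖ ^ 2) =
          ((d / (2 * ‖a‖ ^ 2)) * ⟪a, u⟫ ^ 4 + (‖a‖ ^ 2 / (2 * d)) * ‖u‖ ^ 4)
            - ⟪a, u⟫ ^ 2 * ‖u‖ ^ 2 := by
          field_simp
          ring
        simp only
        linarith
    _ = (d / (2 * ‖a‖ ^ 2)) * (3 * ‖a‖ ^ 4) + (‖a‖ ^ 2 / (2 * d)) *
          ∫ u, ‖u‖ ^ 4 ∂(stdGaussian (EuclideanSpace ℝ (Fin d))) := by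
        rw [integral_add (h4.const_mul _) (hn.const_mul _), integral_const_mul, integral_const_mul,
          integral_inner_pow_four_stdGaussian]
    _ ≤ (d / (2 * ‖a‖ ^ 2)) * (3 * ‖a‖ ^ 4) + (‖a‖ ^ 2 / (2 * d)) * (3 * (d : ℝ) ^ 2) := by
        gcongr
        exact integral_norm_pow_four_stdGaussian_le
    _ = _ := by field_simp; ring

lemma integral_inner_smul_stdGaussian (a : E) :
    ∫ u, ⟪a, u⟫ • u ∂(stdGaussian E) = a := by
  have hint : Integrable (fun u : E => ⟪a, u⟫ • u) (stdGaussian E) := by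
    refine ((integrable_norm_pow_stdGaussian (E := E) 2).const_mul ‖a‖).mono'
      (by fun_prop) (ae_of_all _ fun u => ?_)
    rw [norm_smul, sq, ← mul_assoc]
    gcongr
    exact norm_inner_le_norm _ _
  refine ext_inner_left ℝ fun e => ?_
  rw [← integral_inner hint]
  simp_rw [inner_smul_right]
  rw [integral_inner_mul_inner_stdGaussian, real_inner_comm]

end Moments

/-! ### Smoothing a bounded measurable function at unit scale -/

section WeightedSmoothing

variable {E : Type*} [NormedAddCommGroup E] [InnerProductSpace ℝ E] [FiniteDimensional ℝ E]
  [MeasurableSpace E] [BorelSpace E]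

/-- By Cameron-Martin, the translation is moved from `g`, which need not be continuous, to the
smooth density, and only the density is differentiated. The affine weight covers both uses: `c = 1,
e = 0` gives the gradient of the smoothing, `c = 0` the derivative of the component of that gradient
along `e`. -/
lemma hasFDerivAt_integral_mul_affine {g : E → ℝ} (hg : Measurable g) {B : ℝ}
    (hB : ∀ x, |g x| ≤ B) (c : ℝ) (e y : E) :
    HasFDerivAt (fun z => ∫ u, g (z + u) * (c + ⟪e, u⟫) ∂(stdGaussian E))
      (∫ u, g (y + u) • ((c + ⟪e, u⟫) • innerSL ℝ u - innerSL ℝ e) ∂(stdGaussian E)) y := by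
  have hB0 : 0 ≤ B := (abs_nonneg _).trans (hB 0)
  set F : E → E → ℝ := fun h u =>
    g (y + u) * (Real.exp (⟪h, u⟫ - ‖h‖ ^ 2 / 2) * (c + ⟪e, u - h⟫)) with hF
  set F' : E → E → (E →L[ℝ] ℝ) := fun h u =>
    g (y + u) • (Real.exp (⟪h, u⟫ - ‖h‖ ^ 2 / 2) •
      ((c + ⟪e, u - h⟫) • innerSL ℝ (u - h) - innerSL ℝ e)) with hF'
  have hFF' : ∀ h u, HasFDerivAt (F · u) (F' h u) h := by
    intro h u
    have h1 : HasFDerivAt (fun h : E => ⟪h, u⟫ - ‖h‖ ^ 2 / 2) (innerSL ℝ (u - h)) h := by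
      have a1 : HasFDerivAt (fun h : E => ⟪h, u⟫) (innerSL ℝ u) h := by
        have := (innerSL ℝ u).hasFDerivAt (x := h)
        refine this.congr_of_eventuallyEq (Filter.Eventually.of_forall fun z => ?_)
        simp [real_inner_comm]
      have a2 : HasFDerivAt (fun h : E => ‖h‖ ^ 2 / 2) (innerSL ℝ h) h := by
        refine (((hasStrictFDerivAt_norm_sq h).hasFDerivAt.const_mul (1 / 2)).congr_of_eventuallyEq
          (Filter.Eventually.of_forall fun z => by ring)).congr_fderiv ?_
        ext w
        simp
      refine (a1.sub a2).congr_fderiv ?_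
      ext w
      simp
    have h2 : HasFDerivAt (fun h : E => c + ⟪e, u - h⟫) (-innerSL ℝ e) h := by
      have := ((innerSL ℝ e).hasFDerivAt (x := u - h)).comp h ((hasFDerivAt_id h).const_sub u)
      refine (this.const_add c).congr_fderiv ?_
      ext w
      simp
    refine ((h1.exp.mul h2).const_mul (g (y + u))).congr_fderiv ?_
    ext w
    simp [hF']
    ring
  have hmeasg : Measurable fun u : E => g (y + u) := hg.comp (by fun_prop)
  -- For `‖h‖ ≤ 1` the density is at most `exp ‖u‖`, and the polynomial factor is at most quadratic
  -- in `‖u‖ + 1 ≤ exp ‖u‖`; together this gives `exp (3 ‖u‖)`.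
  have hbound : ∀ u : E, ∀ h ∈ Metric.ball (0 : E) 1,
      ‖F' h u‖ ≤ B * ((|c| + 2 * ‖e‖) * Real.exp (3 * ‖u‖)) := by
    intro u h hh
    have hh1 : ‖h‖ ≤ 1 := by simpa using (Metric.mem_ball.1 hh).le
    have huh : ‖u - h‖ ≤ ‖u‖ + 1 := (norm_sub_le _ _).trans (by linarith)
    have hexp : Real.exp (⟪h, u⟫ - ‖h‖ ^ 2 / 2) ≤ Real.exp ‖u‖ := by
      refine Real.exp_le_exp.2 ?_
      have := real_inner_le_norm h u
      nlinarith [norm_nonneg u, sq_nonneg ‖h‖]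
    have hin : |c + ⟪e, u - h⟫| ≤ |c| + ‖e‖ * (‖u‖ + 1) :=
      (abs_add_le _ _).trans (by gcongr; exact (abs_real_inner_le_norm _ _).trans (by gcongr))
    have hlin : ‖(c + ⟪e, u - h⟫) • innerSL ℝ (u - h) - innerSL ℝ e‖ ≤
        (|c| + ‖e‖ * (‖u‖ + 1)) * (‖u‖ + 1) + ‖e‖ := by
      refine (norm_sub_le _ _).trans ?_
      rw [norm_smul, innerSL_apply_norm, innerSL_apply_norm, Real.norm_eq_abs]
      gcongr
    have hpoly : (|c| + ‖e‖ * (‖u‖ + 1)) * (‖u‖ + 1) + ‖e‖ ≤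
        (|c| + 2 * ‖e‖) * Real.exp (2 * ‖u‖) := by
      have h1 : ‖u‖ + 1 ≤ Real.exp ‖u‖ := Real.add_one_le_exp _
      have h2 : (‖u‖ + 1) ^ 2 ≤ Real.exp (2 * ‖u‖) := by
        rw [two_mul, Real.exp_add, ← sq]
        gcongr
      have h3 : (|c| + ‖e‖ * (‖u‖ + 1)) * (‖u‖ + 1) + ‖e‖ ≤ (|c| + 2 * ‖e‖) * (‖u‖ + 1) ^ 2 := by
        nlinarith [norm_nonneg u, norm_nonneg e, abs_nonneg c,
          mul_nonneg (norm_nonneg e) (norm_nonneg u), mul_nonneg (abs_nonneg c) (norm_nonneg u),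
          mul_nonneg (norm_nonneg e) (sq_nonneg ‖u‖), mul_nonneg (abs_nonneg c) (sq_nonneg ‖u‖)]
      exact h3.trans (by gcongr)
    simp only [hF', norm_smul, Real.norm_eq_abs, abs_of_pos (Real.exp_pos _)]
    calc _ ≤ B * (Real.exp ‖u‖ * ((|c| + 2 * ‖e‖) * Real.exp (2 * ‖u‖))) := by
          gcongr
          · exact hB _
          · exact hlin.trans hpoly
      _ = _ := by
          rw [show 3 * ‖u‖ = ‖u‖ + 2 * ‖u‖ by ring, Real.exp_add]
          ring
  have hFint : Integrable (F 0) (stdGaussian E) := by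
    have : Integrable (fun u : E => B * (|c| + ‖e‖ * ‖u‖ ^ 1)) (stdGaussian E) :=
      ((integrable_const _).add ((integrable_norm_pow_stdGaussian 1).const_mul _)).const_mul _
    refine this.mono' (Measurable.aestronglyMeasurable (by simp only [hF]; fun_prop))
      (ae_of_all _ fun u => ?_)
    simp only [hF, norm_mul, Real.norm_eq_abs]
    simp only [inner_zero_left, norm_zero, sub_zero, pow_one]
    norm_num
    gcongr
    · exact hB _
    · exact (abs_add_le _ _).trans (by gcongr; exact abs_real_inner_le_norm _ _)
  have main := hasFDerivAt_integral_of_dominated_of_fderiv_le (𝕜 := ℝ) (μ := stdGaussian E)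
    (F := F) (F' := F') (x₀ := (0 : E)) (s := Metric.ball 0 1)
    (bound := fun u => B * ((|c| + 2 * ‖e‖) * Real.exp (3 * ‖u‖)))
    (Metric.ball_mem_nhds _ one_pos)
    (Filter.Eventually.of_forall fun h => Measurable.aestronglyMeasurable (by
      simp only [hF]; fun_prop))
    hFint
    (by
      refine (hmeasg.stronglyMeasurable.smul ?_).aestronglyMeasurable
      exact Continuous.stronglyMeasurable (by fun_prop))
    (ae_of_all _ hbound)
    (((integrable_exp_mul_norm_stdGaussian 3).const_mul _).const_mul _)
    (ae_of_all _ fun u h _ => hFF' h u)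
  have hK : (fun z => ∫ u, g (z + u) * (c + ⟪e, u⟫) ∂(stdGaussian E)) =
      (fun h => ∫ u, F h u ∂(stdGaussian E)) ∘ fun z => z - y := by
    funext z
    have := integral_comp_add_stdGaussian (E := E)
      (ψ := fun v => g (y + v) * (c + ⟪e, v - (z - y)⟫))
      (Measurable.stronglyMeasurable (by fun_prop)) (z - y)
    simp only [Function.comp, hF]
    convert this using 3 with u u
    · congr 2
      · abel_nf
      · congr 1; simp
    · rw [smul_eq_mul]; ring
  rw [hK]
  have main' : HasFDerivAt (fun h => ∫ u, F h u ∂(stdGaussian E))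
      (∫ u, F' 0 u ∂(stdGaussian E)) (y - y) := by rwa [sub_self]
  refine (HasFDerivAt.comp (f := fun z => z - y) y main'
    ((hasFDerivAt_id y).sub_const y)).congr_fderiv ?_
  simp [hF']

/-- Cauchy-Schwarz in `L²`, in the form of AM-GM with weights that equalise the second moments
`‖e‖²` and `‖v‖²`. -/
lemma integral_abs_inner_mul_inner_stdGaussian_le (e v : E) :
    ∫ u, |⟪e, u⟫ * ⟪v, u⟫| ∂(stdGaussian E) ≤ ‖e‖ * ‖v‖ := by
  rcases eq_or_ne e 0 with rfl | he
  · simp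
  rcases eq_or_ne v 0 with rfl | hv
  · simp
  have he' := norm_pos_iff.2 he
  have hv' := norm_pos_iff.2 hv
  have i1 := (integrable_inner_pow_stdGaussian e 2).const_mul (‖v‖ / (2 * ‖e‖))
  have i2 := (integrable_inner_pow_stdGaussian v 2).const_mul (‖e‖ / (2 * ‖v‖))
  have hle : ∀ u : E, |⟪e, u⟫ * ⟪v, u⟫| ≤
      ‖v‖ / (2 * ‖e‖) * ⟪e, u⟫ ^ 2 + ‖e‖ / (2 * ‖v‖) * ⟪v, u⟫ ^ 2 := by
    intro u
    have h0 : 0 ≤ (‖v‖ * |⟪e, u⟫| - ‖e‖ * |⟪v, u⟫|) ^ 2 / (2 * ‖e‖ * ‖v‖) := by positivity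
    have h1 : (‖v‖ * |⟪e, u⟫| - ‖e‖ * |⟪v, u⟫|) ^ 2 / (2 * ‖e‖ * ‖v‖) =
        ‖v‖ / (2 * ‖e‖) * |⟪e, u⟫| ^ 2 + ‖e‖ / (2 * ‖v‖) * |⟪v, u⟫| ^ 2 - |⟪e, u⟫| * |⟪v, u⟫| := by
      field_simp
      ring
    rw [abs_mul, ← sq_abs ⟪e, u⟫, ← sq_abs ⟪v, u⟫]
    linarith
  calc _ ≤ ∫ u, (‖v‖ / (2 * ‖e‖) * ⟪e, u⟫ ^ 2 + ‖e‖ / (2 * ‖v‖) * ⟪v, u⟫ ^ 2) ∂(stdGaussian E) :=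
        integral_mono_of_nonneg (ae_of_all _ fun u => abs_nonneg _) (i1.add i2) (ae_of_all _ hle)
    _ = _ := by
      rw [integral_add i1 i2, integral_const_mul, integral_const_mul]
      simp_rw [sq, integral_inner_mul_inner_stdGaussian, real_inner_self_eq_norm_sq]
      field_simp
      ring

lemma integrable_inner_mul_inner_stdGaussian (e v : E) :
    Integrable (fun u => ⟪e, u⟫ * ⟪v, u⟫) (stdGaussian E) := by
  refine ((integrable_norm_pow_stdGaussian (E := E) 2).const_mul (‖e‖ * ‖v‖)).mono'
    (by fun_prop) (ae_of_all _ fun u => ?_)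
  rw [norm_mul]
  calc _ ≤ (‖e‖ * ‖u‖) * (‖v‖ * ‖u‖) := by
        gcongr <;> exact norm_inner_le_norm _ _
    _ = _ := by ring

lemma integrable_smul_inner_smul_sub {g : E → ℝ} (hg : Measurable g) {B : ℝ}
    (hB : ∀ x, |g x| ≤ B) (c : ℝ) (e : E) :
    Integrable (fun u => g u • ((c + ⟪e, u⟫) • innerSL ℝ u - innerSL ℝ e)) (stdGaussian E) := by
  have hB0 : 0 ≤ B := (abs_nonneg _).trans (hB 0)
  have hi := (((integrable_norm_pow_stdGaussian (E := E) 1).const_mul |c|).add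
    (((integrable_norm_pow_stdGaussian (E := E) 2).const_mul ‖e‖).add
      (integrable_const ‖e‖))).const_mul B
  refine hi.mono' ?_ (ae_of_all _ fun u => ?_)
  · exact (hg.stronglyMeasurable.smul
      (Continuous.stronglyMeasurable (by fun_prop))).aestronglyMeasurable
  · rw [norm_smul, Real.norm_eq_abs]
    simp only [Pi.add_apply]
    gcongr
    · exact hB u
    · refine (norm_sub_le _ _).trans ?_
      rw [norm_smul, innerSL_apply_norm, innerSL_apply_norm, Real.norm_eq_abs]
      calc _ ≤ (|c| + ‖e‖ * ‖u‖) * ‖u‖ + ‖e‖ := by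
            gcongr
            exact (abs_add_le _ _).trans (by gcongr; exact abs_real_inner_le_norm _ _)
        _ = _ := by ring

lemma norm_integral_smul_inner_smul_sub_le {g : E → ℝ} (hg : Measurable g) {B : ℝ}
    (hB : ∀ x, |g x| ≤ B) (e : E) :
    ‖∫ u, g u • ((0 + ⟪e, u⟫) • innerSL ℝ u - innerSL ℝ e) ∂(stdGaussian E)‖ ≤ 2 * B * ‖e‖ := by
  have hB0 : 0 ≤ B := (abs_nonneg _).trans (hB 0)
  refine ContinuousLinearMap.opNorm_le_bound _ (by positivity) fun v => ?_
  rw [ContinuousLinearMap.integral_apply (integrable_smul_inner_smul_sub hg hB 0 e)]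
  have hi : Integrable (fun u => B * (|⟪e, u⟫ * ⟪v, u⟫| + ‖e‖ * ‖v‖)) (stdGaussian E) :=
    ((integrable_inner_mul_inner_stdGaussian e v).abs.add (integrable_const _)).const_mul _
  calc _ ≤ ∫ u, B * (|⟪e, u⟫ * ⟪v, u⟫| + ‖e‖ * ‖v‖) ∂(stdGaussian E) := by
        refine norm_integral_le_of_norm_le hi (ae_of_all _ fun u => ?_)
        simp only [zero_add, smul_apply, sub_apply,
          innerSL_apply_apply ℝ, smul_eq_mul, norm_mul, Real.norm_eq_abs]
        gcongr
        · exact hB u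
        · refine (abs_sub _ _).trans ?_
          rw [real_inner_comm v u]
          gcongr
          exact abs_real_inner_le_norm _ _
    _ = B * (∫ u, |⟪e, u⟫ * ⟪v, u⟫| ∂(stdGaussian E) + ‖e‖ * ‖v‖) := by
        rw [integral_const_mul, integral_add (integrable_inner_mul_inner_stdGaussian e v).abs
          (integrable_const _)]
        simp
    _ ≤ B * (‖e‖ * ‖v‖ + ‖e‖ * ‖v‖) := by
        gcongr
        exact integral_abs_inner_mul_inner_stdGaussian_le e v
    _ = _ := by ring

lemma integrable_smul_stdGaussian {g : E → ℝ} (hg : Measurable g) {B : ℝ}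
    (hB : ∀ x, |g x| ≤ B) : Integrable (fun u => g u • u) (stdGaussian E) := by
  refine ((integrable_norm_pow_stdGaussian (E := E) 1).const_mul B).mono'
    (by fun_prop) (ae_of_all _ fun u => ?_)
  rw [norm_smul, pow_one]
  gcongr
  exact hB u

lemma norm_integral_smul_sub_le {g : E → ℝ} (hg : Measurable g) {B : ℝ}
    (hB : ∀ x, |g x| ≤ B) (y z : E) :
    ‖∫ u, g (y + u) • u ∂(stdGaussian E) - ∫ u, g (z + u) • u ∂(stdGaussian E)‖ ≤
      2 * B * ‖y - z‖ := by
  have hgm (x : E) : Measurable fun u => g (x + u) := hg.comp (by fun_prop)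
  set Q : E → E := fun y => ∫ u, g (y + u) • u ∂(stdGaussian E)
  change ‖Q y - Q z‖ ≤ _
  have hQ : ∀ e x, ⟪e, Q x⟫ = ∫ u, g (x + u) * (0 + ⟪e, u⟫) ∂(stdGaussian E) := by
    intro e x
    simp only [Q]
    rw [← integral_inner (integrable_smul_stdGaussian (hgm x) fun u => hB (x + u))]
    simp [inner_smul_right]
  have hlip : ∀ e, ‖⟪e, Q y⟫ - ⟪e, Q z⟫‖ ≤ (2 * B * ‖e‖) * ‖y - z‖ := by
    intro e
    rw [hQ, hQ]
    exact Convex.norm_image_sub_le_of_norm_hasFDerivWithin_le (s := Set.univ)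
      (f := fun x => ∫ u, g (x + u) * (0 + ⟪e, u⟫) ∂(stdGaussian E))
      (fun x _ => (hasFDerivAt_integral_mul_affine hg hB 0 e x).hasFDerivWithinAt)
      (fun x _ => norm_integral_smul_inner_smul_sub_le (hgm x) (fun u => hB (x + u)) e)
      convex_univ (Set.mem_univ _) (Set.mem_univ _)
  -- Testing against the difference itself bounds its square; one factor is then cancelled.
  have h := hlip (Q y - Q z)
  rw [← inner_sub_right, real_inner_self_eq_norm_sq, Real.norm_of_nonneg (by positivity)] at h
  rcases eq_or_ne (‖Q y - Q z‖) 0 with h0 | h0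
  · rw [h0]
    have := (abs_nonneg _).trans (hB 0)
    positivity
  · have hpos : 0 < ‖Q y - Q z‖ := lt_of_le_of_ne (norm_nonneg _) (Ne.symm h0)
    refine le_of_mul_le_mul_left ?_ hpos
    linarith

end WeightedSmoothing

/-! ### Gradient and smoothness of the Gaussian smoothing -/

section Smoothing

variable {d : ℕ}

lemma hasGradientAt_gaussianSmoothing {g : EuclideanSpace ℝ (Fin d) → ℝ} (hg : Measurable g)
    {B : ℝ} (hB : ∀ x, |g x| ≤ B) {t : ℝ} (ht : 0 < t) (x : EuclideanSpace ℝ (Fin d)) :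
    HasGradientAt (gaussianSmoothing g t)
      (t⁻¹ • ∫ u, g (x + t • u) • u ∂(stdGaussian (EuclideanSpace ℝ (Fin d)))) x := by
  have hgt : Measurable fun v => g (t • v) := hg.comp (by fun_prop)
  have h1 := hasFDerivAt_integral_mul_affine hgt (fun v => hB (t • v)) 1 0 (t⁻¹ • x)
  have h2 := h1.comp x ((hasFDerivAt_id x).const_smul t⁻¹)
  have hsc : ∀ z u : EuclideanSpace ℝ (Fin d), t • (t⁻¹ • z + u) = z + t • u := by
    intro z u
    rw [smul_add, smul_inv_smul₀ ht.ne']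
  have hgx : Measurable fun u => g (x + t • u) := hg.comp (by fun_prop)
  have i1 := integrable_smul_inner_smul_sub hgx (fun v => hB _) 1 0
  have i2 := integrable_smul_stdGaussian hgx (fun v => hB _)
  rw [hasGradientAt_iff_hasFDerivAt]
  refine (h2.congr_of_eventuallyEq (Filter.Eventually.of_forall fun z => ?_)).congr_fderiv ?_
  · simp only [gaussianSmoothing, Function.comp, hsc]
    simp
  · ext v
    simp only [hsc, ContinuousLinearMap.comp_apply, smul_apply,
      InnerProductSpace.toDual_apply_apply]
    rw [ContinuousLinearMap.integral_apply i1, real_inner_comm, inner_smul_right,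
      ← integral_inner i2, ← integral_const_mul]
    refine integral_congr_ae (ae_of_all _ fun u => ?_)
    simp [inner_smul_right, real_inner_comm]

lemma IsSmoothWith.continuous_gradient {K : ℝ} {h : EuclideanSpace ℝ (Fin d) → ℝ}
    (hh : IsSmoothWith K h) : Continuous (gradient h) :=
  (LipschitzWith.of_dist_le_mul (K := K.toNNReal) fun x y => by
    rw [dist_eq_norm, dist_eq_norm]
    exact (hh.gradient_lipschitz x y).trans (by gcongr; exact Real.le_coe_toNNReal K)).continuous

lemma norm_gradient_le_of_lipschitz {f : EuclideanSpace ℝ (Fin d) → ℝ} {L₀ : ℝ} (hL₀ : 0 ≤ L₀)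
    (hf : ∀ x y, |f x - f y| ≤ L₀ * ‖x - y‖) (x : EuclideanSpace ℝ (Fin d)) :
    ‖gradient f x‖ ≤ L₀ := by
  have hl : LipschitzWith L₀.toNNReal f := LipschitzWith.of_dist_le_mul fun x y => by
    rw [Real.dist_eq, dist_eq_norm, Real.coe_toNNReal _ hL₀]
    exact hf x y
  have := norm_fderiv_le_of_lipschitz ℝ hl (x₀ := x)
  rw [Real.coe_toNNReal _ hL₀] at this
  rwa [gradient, LinearIsometryEquiv.norm_map]

lemma hasGradientAt_gaussianSmoothing_of_isSmoothWith {f : EuclideanSpace ℝ (Fin d) → ℝ}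
    {L₀ L₁ B : ℝ} (hL₀ : 0 ≤ L₀) (hlip : ∀ x y, |f x - f y| ≤ L₀ * ‖x - y‖)
    (hf : IsSmoothWith L₁ f) (hB : ∀ x, |f x| ≤ B) (t : ℝ) (x : EuclideanSpace ℝ (Fin d)) :
    HasGradientAt (gaussianSmoothing f t)
      (∫ u, gradient f (x + t • u) ∂(stdGaussian (EuclideanSpace ℝ (Fin d)))) x := by
  have hcont : Continuous f := hf.differentiable.continuous
  have hgc := hf.continuous_gradient
  have hfd : ∀ y, fderiv ℝ f y = InnerProductSpace.toDual ℝ _ (gradient f y) := by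
    intro y
    simp [gradient]
  have hfc : Continuous (fderiv ℝ f) := by
    rw [funext hfd]
    exact (InnerProductSpace.toDual ℝ _).continuous.comp hgc
  have main := hasFDerivAt_integral_of_dominated_of_fderiv_le (𝕜 := ℝ)
    (μ := stdGaussian (EuclideanSpace ℝ (Fin d)))
    (F := fun y u => f (y + t • u)) (F' := fun y u => fderiv ℝ f (y + t • u)) (x₀ := x)
    (s := Set.univ) (bound := fun _ => L₀) Filter.univ_mem
    (Filter.Eventually.of_forall fun y => by fun_prop)
    ((integrable_const B).mono' (by fun_prop) (ae_of_all _ fun u => hB _))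
    (by fun_prop)
    (ae_of_all _ fun u y _ => by
      rw [hfd, LinearIsometryEquiv.norm_map]
      exact norm_gradient_le_of_lipschitz hL₀ hlip _)
    (integrable_const _)
    (ae_of_all _ fun u y _ => by
      exact ((hf.differentiable (y + t • u)).hasFDerivAt.comp y
        ((hasFDerivAt_id y).add_const (t • u))).congr_fderiv (by ext; simp))
  rw [hasGradientAt_iff_hasFDerivAt]
  refine main.congr_fderiv ?_
  simp_rw [hfd]
  exact ContinuousLinearMap.integral_comp_comm
    (InnerProductSpace.toDual ℝ (EuclideanSpace ℝ (Fin d))).toContinuousLinearEquiv.toContinuousLinearMap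
    ((integrable_const L₀).mono' (by fun_prop)
      (ae_of_all _ fun u => norm_gradient_le_of_lipschitz hL₀ hlip _))

/-- The Gaussian smoothing of an inexact evaluation `f'` of an `L₁`-smooth function is
`(L₁ + 2ν / t²)`-smooth. -/
lemma isSmoothWith_gaussianSmoothing {f f' : EuclideanSpace ℝ (Fin d) → ℝ} {L₀ L₁ B ν t : ℝ}
    (hL₀ : 0 ≤ L₀) (hlip : ∀ x y, |f x - f y| ≤ L₀ * ‖x - y‖) (hf : IsSmoothWith L₁ f)
    (hB : ∀ x, |f x| ≤ B) (hf' : Measurable f') (hν : ∀ x, |f x - f' x| ≤ ν) (ht : 0 < t) :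
    IsSmoothWith (L₁ + 2 * ν / t ^ 2) (gaussianSmoothing f' t) := by
  set γ := stdGaussian (EuclideanSpace ℝ (Fin d))
  have hfm : Measurable f := hf.differentiable.continuous.measurable
  -- The smooth part and the bounded perturbation are smoothed separately; only the latter
  -- contributes the singular term in `t`.
  set g : EuclideanSpace ℝ (Fin d) → ℝ := fun x => f' x - f x with hgdef
  have hg : Measurable g := hf'.sub hfm
  have hgν : ∀ x, |g x| ≤ ν := fun x => by
    rw [hgdef, abs_sub_comm]
    exact hν x
  have hadd : gaussianSmoothing f' t = fun x => gaussianSmoothing f t x + gaussianSmoothing g t x := by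
    funext x
    simp only [gaussianSmoothing]
    rw [← integral_add]
    · simp [hgdef]
    · exact (integrable_const B).mono'
        (hfm.comp (by fun_prop)).aestronglyMeasurable (ae_of_all _ fun u => hB _)
    · exact (integrable_const ν).mono' (hg.comp (by fun_prop)).aestronglyMeasurable (ae_of_all _ fun u => hgν _)
  have hgrad : ∀ x, HasGradientAt (gaussianSmoothing f' t)
      (∫ u, gradient f (x + t • u) ∂γ + t⁻¹ • ∫ u, g (x + t • u) • u ∂γ) x := by
    intro x
    have h1 := hasGradientAt_gaussianSmoothing_of_isSmoothWith hL₀ hlip hf hB t x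
    have h2 := hasGradientAt_gaussianSmoothing hg hgν ht x
    rw [hasGradientAt_iff_hasFDerivAt] at *
    rw [hadd, map_add]
    exact h1.add h2
  refine ⟨fun x => (hgrad x).differentiableAt, fun x y => ?_⟩
  rw [(hgrad x).gradient, (hgrad y).gradient]
  have hgi : ∀ x, Integrable (fun u => gradient f (x + t • u)) γ := fun x =>
    (integrable_const L₀).mono' (by have := hf.continuous_gradient; fun_prop)
      (ae_of_all _ fun u => norm_gradient_le_of_lipschitz hL₀ hlip _)
  have b1 : ‖∫ u, gradient f (x + t • u) ∂γ - ∫ u, gradient f (y + t • u) ∂γ‖ ≤ L₁ * ‖x - y‖ := by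
    rw [← integral_sub (hgi x) (hgi y)]
    refine (norm_integral_le_of_norm_le_const (C := L₁ * ‖x - y‖) (ae_of_all _ fun u => ?_)).trans
      (by simp)
    simpa using hf.gradient_lipschitz (x + t • u) (y + t • u)
  -- The unit-scale bound is applied to `v ↦ g (t • v)`. This rescaling gives one factor `t⁻¹`; the
  -- other is in the gradient formula.
  have b2 : ‖∫ u, g (x + t • u) • u ∂γ - ∫ u, g (y + t • u) • u ∂γ‖ ≤ 2 * ν * (t⁻¹ * ‖x - y‖) := by
    have := norm_integral_smul_sub_le (g := fun v => g (t • v)) (hg.comp (by fun_prop))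
      (fun v => hgν _) (t⁻¹ • x) (t⁻¹ • y)
    rw [← smul_sub, norm_smul, Real.norm_of_nonneg (by positivity)] at this
    simpa only [smul_add, smul_inv_smul₀ ht.ne'] using this
  calc _ = ‖(∫ u, gradient f (x + t • u) ∂γ - ∫ u, gradient f (y + t • u) ∂γ) +
        t⁻¹ • (∫ u, g (x + t • u) • u ∂γ - ∫ u, g (y + t • u) • u ∂γ)‖ := by
        rw [smul_sub]; congr 1; abel
    _ ≤ L₁ * ‖x - y‖ + t⁻¹ * (2 * ν * (t⁻¹ * ‖x - y‖)) := by
        refine (norm_add_le _ _).trans ?_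
        rw [norm_smul, Real.norm_of_nonneg (by positivity : 0 ≤ t⁻¹)]
        gcongr
    _ = _ := by field_simp

end Smoothing

/-! ### Expected decrease in one step -/

section Step

lemma sq_integral_le_integral_sq {Ω : Type*} [MeasurableSpace Ω] {P : Measure Ω}
    [IsProbabilityMeasure P] {X : Ω → ℝ} (hX : Integrable X P)
    (hX2 : Integrable (fun ω => X ω ^ 2) P) : (∫ ω, X ω ∂P) ^ 2 ≤ ∫ ω, X ω ^ 2 ∂P := by
  set c := ∫ ω, X ω ∂P with hc
  have h0 : 0 ≤ ∫ ω, (X ω - c) ^ 2 ∂P := integral_nonneg fun ω => sq_nonneg _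
  have e : ∀ ω, (X ω - c) ^ 2 = X ω ^ 2 - 2 * c * X ω + c ^ 2 := fun ω => by ring
  simp_rw [e] at h0
  have i1 : Integrable (fun ω => X ω ^ 2 - 2 * c * X ω) P := hX2.sub (hX.const_mul _)
  rw [integral_add i1 (integrable_const _), integral_sub hX2 (hX.const_mul _),
    integral_const_mul, ← hc] at h0
  simp at h0
  nlinarith

variable {d : ℕ}

/-- The mean value inequality on the segment; it gives `K` in place of the sharp `K / 2`, which the
step size can afford. -/
lemma IsSmoothWith.abs_sub_sub_inner_le {K : ℝ} (hK : 0 ≤ K)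
    {h : EuclideanSpace ℝ (Fin d) → ℝ} (hh : IsSmoothWith K h) (x y : EuclideanSpace ℝ (Fin d)) :
    |h y - h x - ⟪gradient h x, y - x⟫| ≤ K * ‖y - x‖ ^ 2 := by
  have := Convex.norm_image_sub_le_of_norm_hasFDerivWithin_le' (s := segment ℝ x y) (f := h)
    (f' := fun z => InnerProductSpace.toDual ℝ _ (gradient h z))
    (φ := InnerProductSpace.toDual ℝ _ (gradient h x)) (C := K * ‖y - x‖)
    (fun z _ => ((hh.differentiable z).hasGradientAt.hasFDerivAt).hasFDerivWithinAt)
    (fun z hz => by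
      rw [← map_sub, LinearIsometryEquiv.norm_map]
      refine (hh.gradient_lipschitz z x).trans ?_
      gcongr
      obtain ⟨s, ⟨hs0, hs1⟩, rfl⟩ := (segment_eq_image' ℝ x y ▸ hz)
      rw [add_sub_cancel_left, norm_smul, Real.norm_of_nonneg hs0]
      exact mul_le_of_le_one_left (norm_nonneg _) hs1)
    (convex_segment x y) (left_mem_segment ℝ x y) (right_mem_segment ℝ x y)
  rw [Real.norm_eq_abs, InnerProductSpace.toDual_apply_apply] at this
  linarith

/-- The error of the finite difference of `f'` along `t • u` as an approximation of the directional
derivative of `f`. -/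
noncomputable def differenceError (f f' : EuclideanSpace ℝ (Fin d) → ℝ)
    (x : EuclideanSpace ℝ (Fin d)) (t : ℝ) (u : EuclideanSpace ℝ (Fin d)) : ℝ :=
  (f' (x + t • u) - f' x) / t - ⟪gradient f x, u⟫

lemma measurable_differenceError {f f' : EuclideanSpace ℝ (Fin d) → ℝ} (hf' : Measurable f')
    (x : EuclideanSpace ℝ (Fin d)) (t : ℝ) : Measurable (differenceError f f' x t) := by
  unfold differenceError
  fun_prop

lemma zoGradient_eq (f f' : EuclideanSpace ℝ (Fin d) → ℝ) (x : EuclideanSpace ℝ (Fin d)) (t : ℝ)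
    (u : EuclideanSpace ℝ (Fin d)) :
    zoGradient f' x t u = (⟪gradient f x, u⟫ + differenceError f f' x t u) • u := by
  simp [zoGradient, differenceError]

lemma abs_differenceError_le {f f' : EuclideanSpace ℝ (Fin d) → ℝ} {L₁ ν t : ℝ} (hL₁ : 0 ≤ L₁)
    (hf : IsSmoothWith L₁ f) (hν : ∀ x, |f x - f' x| ≤ ν) (ht : 0 < t)
    (x u : EuclideanSpace ℝ (Fin d)) :
    |differenceError f f' x t u| ≤ 2 * ν / t + L₁ * t * ‖u‖ ^ 2 := by
  have h := hf.abs_sub_sub_inner_le hL₁ x (x + t • u)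
  rw [add_sub_cancel_left, inner_smul_right, norm_smul, Real.norm_of_nonneg ht.le] at h
  have h1 := hν x
  have h2 := hν (x + t • u)
  have e : differenceError f f' x t u =
      (f' (x + t • u) - f' x - t * ⟪gradient f x, u⟫) / t := by
    simp only [differenceError]
    field_simp
  rw [e, abs_div, abs_of_pos ht, div_le_iff₀ ht]
  have e2 : (2 * ν / t + L₁ * t * ‖u‖ ^ 2) * t = 2 * ν + L₁ * (t * ‖u‖) ^ 2 := by
    field_simp
  rw [e2]
  rw [abs_le] at *
  constructor <;> linarith [h.1, h.2, h1.1, h1.2, h2.1, h2.2]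

lemma differenceError_sq_mul_norm_sq_le {f f' : EuclideanSpace ℝ (Fin d) → ℝ} {L₁ ν t : ℝ}
    (hL₁ : 0 ≤ L₁) (hf : IsSmoothWith L₁ f) (hν : ∀ x, |f x - f' x| ≤ ν) (ht : 0 < t)
    (x u : EuclideanSpace ℝ (Fin d)) :
    differenceError f f' x t u ^ 2 * ‖u‖ ^ 2 ≤
      8 * ν ^ 2 / t ^ 2 * ‖u‖ ^ 2 + 2 * L₁ ^ 2 * t ^ 2 * ‖u‖ ^ 6 := by
  have h := abs_differenceError_le hL₁ hf hν ht x u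
  rw [← sq_abs (differenceError f f' x t u)]
  calc _ ≤ (2 * ν / t + L₁ * t * ‖u‖ ^ 2) ^ 2 * ‖u‖ ^ 2 := by gcongr
    _ ≤ (2 * ((2 * ν / t) ^ 2 + (L₁ * t * ‖u‖ ^ 2) ^ 2)) * ‖u‖ ^ 2 := by
        gcongr
        exact add_sq_le
    _ = _ := by ring

lemma integrable_differenceError_sq {f f' : EuclideanSpace ℝ (Fin d) → ℝ} {L₁ ν t : ℝ}
    (hL₁ : 0 ≤ L₁) (hf : IsSmoothWith L₁ f) (hf' : Measurable f') (hν : ∀ x, |f x - f' x| ≤ ν)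
    (ht : 0 < t) (x : EuclideanSpace ℝ (Fin d)) :
    Integrable (fun u => differenceError f f' x t u ^ 2 * ‖u‖ ^ 2)
      (stdGaussian (EuclideanSpace ℝ (Fin d))) := by
  have hm := measurable_differenceError (f := f) hf' x t
  refine (((integrable_norm_pow_stdGaussian 2).const_mul (8 * ν ^ 2 / t ^ 2)).add
    ((integrable_norm_pow_stdGaussian 6).const_mul (2 * L₁ ^ 2 * t ^ 2))).mono'
    (by fun_prop) (ae_of_all _ fun u => ?_)
  rw [Real.norm_of_nonneg (by positivity)]
  exact differenceError_sq_mul_norm_sq_le hL₁ hf hν ht x u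

lemma integral_differenceError_sq_le {f f' : EuclideanSpace ℝ (Fin d) → ℝ} {L₁ ν t : ℝ}
    (hL₁ : 0 ≤ L₁) (hf : IsSmoothWith L₁ f) (hf' : Measurable f') (hν : ∀ x, |f x - f' x| ≤ ν)
    (ht : 0 < t) (x : EuclideanSpace ℝ (Fin d)) :
    ∫ u, differenceError f f' x t u ^ 2 * ‖u‖ ^ 2 ∂(stdGaussian (EuclideanSpace ℝ (Fin d))) ≤
      8 * ν ^ 2 / t ^ 2 * d + 30 * L₁ ^ 2 * t ^ 2 * d ^ 3 := by
  have i2 := (integrable_norm_pow_stdGaussian (E := EuclideanSpace ℝ (Fin d)) 2).const_mul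
    (8 * ν ^ 2 / t ^ 2)
  have i6 := (integrable_norm_pow_stdGaussian (E := EuclideanSpace ℝ (Fin d)) 6).const_mul
    (2 * L₁ ^ 2 * t ^ 2)
  refine (integral_mono (integrable_differenceError_sq hL₁ hf hf' hν ht x) (i2.add i6)
    (differenceError_sq_mul_norm_sq_le hL₁ hf hν ht x)).trans ?_
  simp only [Pi.add_apply]
  rw [integral_add i2 i6, integral_const_mul, integral_const_mul, integral_norm_sq_stdGaussian]
  have : 2 * L₁ ^ 2 * t ^ 2 * ∫ u, ‖u‖ ^ 6 ∂(stdGaussian (EuclideanSpace ℝ (Fin d))) ≤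
      2 * L₁ ^ 2 * t ^ 2 * (15 * (d : ℝ) ^ 3) := by
    gcongr
    exact integral_norm_pow_six_stdGaussian_le
  linarith

lemma norm_zoGradient_sq_le (f f' : EuclideanSpace ℝ (Fin d) → ℝ) (x : EuclideanSpace ℝ (Fin d))
    (t : ℝ) (u : EuclideanSpace ℝ (Fin d)) :
    ‖zoGradient f' x t u‖ ^ 2 ≤ 2 * (⟪gradient f x, u⟫ ^ 2 * ‖u‖ ^ 2) +
      2 * (differenceError f f' x t u ^ 2 * ‖u‖ ^ 2) := by
  rw [zoGradient_eq f, norm_smul, mul_pow, Real.norm_eq_abs, sq_abs]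
  calc _ ≤ (2 * (⟪gradient f x, u⟫ ^ 2 + differenceError f f' x t u ^ 2)) * ‖u‖ ^ 2 := by
        gcongr
        exact add_sq_le
    _ = _ := by ring

lemma measurable_zoGradient {f' : EuclideanSpace ℝ (Fin d) → ℝ} (hf' : Measurable f')
    {α : Type*} [MeasurableSpace α] {x u : α → EuclideanSpace ℝ (Fin d)} {t : α → ℝ}
    (hx : Measurable x) (ht : Measurable t) (hu : Measurable u) :
    Measurable fun a => zoGradient f' (x a) (t a) (u a) := by
  unfold zoGradient
  fun_prop

lemma integrable_norm_zoGradient_sq {f f' : EuclideanSpace ℝ (Fin d) → ℝ} {L₁ ν t : ℝ}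
    (hL₁ : 0 ≤ L₁) (hf : IsSmoothWith L₁ f) (hf' : Measurable f') (hν : ∀ x, |f x - f' x| ≤ ν)
    (ht : 0 < t) (x : EuclideanSpace ℝ (Fin d)) :
    Integrable (fun u => ‖zoGradient f' x t u‖ ^ 2) (stdGaussian (EuclideanSpace ℝ (Fin d))) := by
  have hm := measurable_zoGradient hf' (measurable_const (a := x))
    (measurable_const (a := t)) measurable_id
  have hi : Integrable (fun u => 2 * (⟪gradient f x, u⟫ ^ 2 * ‖u‖ ^ 2) +
      2 * (differenceError f f' x t u ^ 2 * ‖u‖ ^ 2)) (stdGaussian (EuclideanSpace ℝ (Fin d))) :=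
    ((integrable_inner_sq_mul_norm_sq_stdGaussian (gradient f x)).const_mul 2).add
      ((integrable_differenceError_sq hL₁ hf hf' hν ht x).const_mul 2)
  refine hi.mono' (hm.norm.pow_const 2).aestronglyMeasurable (ae_of_all _ fun u => ?_)
  rw [Real.norm_of_nonneg (by positivity)]
  exact norm_zoGradient_sq_le f f' x t u

lemma integral_norm_zoGradient_sq_le (hd : 1 ≤ d) {f f' : EuclideanSpace ℝ (Fin d) → ℝ}
    {L₁ ν t : ℝ} (hL₁ : 0 ≤ L₁) (hf : IsSmoothWith L₁ f) (hf' : Measurable f')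
    (hν : ∀ x, |f x - f' x| ≤ ν) (ht : 0 < t) (x : EuclideanSpace ℝ (Fin d)) :
    ∫ u, ‖zoGradient f' x t u‖ ^ 2 ∂(stdGaussian (EuclideanSpace ℝ (Fin d))) ≤
      6 * d * ‖gradient f x‖ ^ 2 +
      2 * ∫ u, differenceError f f' x t u ^ 2 * ‖u‖ ^ 2
        ∂(stdGaussian (EuclideanSpace ℝ (Fin d))) := by
  have i1 := (integrable_inner_sq_mul_norm_sq_stdGaussian (gradient f x)).const_mul 2
  have i2 := (integrable_differenceError_sq hL₁ hf hf' hν ht x).const_mul 2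
  refine (integral_mono (integrable_norm_zoGradient_sq hL₁ hf hf' hν ht x) (i1.add i2)
    (norm_zoGradient_sq_le f f' x t)).trans ?_
  simp only [Pi.add_apply]
  rw [integral_add i1 i2, integral_const_mul, integral_const_mul]
  linarith [integral_inner_sq_mul_norm_sq_stdGaussian_le hd (gradient f x)]

lemma integrable_zoGradient {f' : EuclideanSpace ℝ (Fin d) → ℝ} (hf' : Measurable f') {B : ℝ}
    (hB : ∀ x, |f' x| ≤ B) (x : EuclideanSpace ℝ (Fin d)) (t : ℝ) :
    Integrable (fun u => zoGradient f' x t u) (stdGaussian (EuclideanSpace ℝ (Fin d))) := by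
  have h0 : (0 : ℝ) ≤ B := (abs_nonneg _).trans (hB 0)
  refine integrable_smul_stdGaussian (g := fun u => (f' (x + t • u) - f' x) / t)
    (B := 2 * B / |t|) (by fun_prop) fun u => ?_
  rw [abs_div]
  gcongr
  exact (abs_sub _ _).trans (by linarith [hB (x + t • u), hB x])

/-- Unbiasedness: the subtracted baseline `f' x • u` has mean zero. -/
lemma integral_zoGradient {f' : EuclideanSpace ℝ (Fin d) → ℝ} (hf' : Measurable f') {B : ℝ}
    (hB : ∀ x, |f' x| ≤ B) {t : ℝ} (ht : 0 < t) (x : EuclideanSpace ℝ (Fin d)) :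
    ∫ u, zoGradient f' x t u ∂(stdGaussian (EuclideanSpace ℝ (Fin d))) =
      gradient (gaussianSmoothing f' t) x := by
  have i1 : Integrable (fun u => f' (x + t • u) • u) (stdGaussian (EuclideanSpace ℝ (Fin d))) :=
    integrable_smul_stdGaussian (g := fun u => f' (x + t • u)) (by fun_prop) fun u => hB _
  have i2 : Integrable (fun u => f' x • u) (stdGaussian (EuclideanSpace ℝ (Fin d))) :=
    integrable_smul_stdGaussian (g := fun u => f' x) (by fun_prop) fun u => hB _
  have e : ∀ u, zoGradient f' x t u = t⁻¹ • (f' (x + t • u) • u - f' x • u) := by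
    intro u
    rw [zoGradient, ← sub_smul, smul_smul, div_eq_inv_mul]
  simp_rw [e]
  rw [(hasGradientAt_gaussianSmoothing hf' hB ht x).gradient, integral_smul, integral_sub i1 i2,
    integral_smul, integral_id_stdGaussian]
  simp

/-- Since `𝔼 ⟪a, u⟫ u = a`, both gradients are means over the same `u`; their difference is the mean
of the error times `u`, and Jensen's inequality applies. -/
lemma norm_gradient_gaussianSmoothing_sub_sq_le {f f' : EuclideanSpace ℝ (Fin d) → ℝ}
    {L₁ ν t B : ℝ} (hL₁ : 0 ≤ L₁) (hf : IsSmoothWith L₁ f) (hf' : Measurable f')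
    (hν : ∀ x, |f x - f' x| ≤ ν) (hB : ∀ x, |f' x| ≤ B) (ht : 0 < t)
    (x : EuclideanSpace ℝ (Fin d)) :
    ‖gradient (gaussianSmoothing f' t) x - gradient f x‖ ^ 2 ≤
      ∫ u, differenceError f f' x t u ^ 2 * ‖u‖ ^ 2
        ∂(stdGaussian (EuclideanSpace ℝ (Fin d))) := by
  have i1 := integrable_zoGradient hf' hB x t
  have i2 : Integrable (fun u => ⟪gradient f x, u⟫ • u)
      (stdGaussian (EuclideanSpace ℝ (Fin d))) := by
    refine ((integrable_norm_pow_stdGaussian 2).const_mul ‖gradient f x‖).mono'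
      (by fun_prop) (ae_of_all _ fun u => ?_)
    rw [norm_smul, sq, ← mul_assoc]
    gcongr
    exact norm_inner_le_norm _ _
  have e : ∀ u, zoGradient f' x t u - ⟪gradient f x, u⟫ • u = differenceError f f' x t u • u := by
    intro u
    rw [zoGradient_eq f, add_smul, add_sub_cancel_left]
  have i3 : Integrable (fun u => differenceError f f' x t u • u)
      (stdGaussian (EuclideanSpace ℝ (Fin d))) := by
    simp_rw [← e]
    exact i1.sub i2
  have e2 : ∀ u, ‖differenceError f f' x t u • u‖ ^ 2 =
      differenceError f f' x t u ^ 2 * ‖u‖ ^ 2 := by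
    intro u
    rw [norm_smul, mul_pow, Real.norm_eq_abs, sq_abs]
  have h := sq_integral_le_integral_sq i3.norm
    (by simp_rw [e2]; exact integrable_differenceError_sq hL₁ hf hf' hν ht x)
  simp_rw [e2] at h
  refine le_trans ?_ h
  rw [← integral_zoGradient hf' hB ht x]
  nth_rewrite 1 [← integral_inner_smul_stdGaussian (gradient f x)]
  rw [← integral_sub i1 i2]
  simp_rw [e]
  gcongr
  exact norm_integral_le_integral_norm _

/-- The first-order Taylor term has mean zero, so only the second-order remainder and the evaluation
error survive. -/
lemma abs_gaussianSmoothing_sub_le {f f' : EuclideanSpace ℝ (Fin d) → ℝ} {L₁ ν t B : ℝ}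
    (hL₁ : 0 ≤ L₁) (hf : IsSmoothWith L₁ f) (hf' : Measurable f')
    (hν : ∀ x, |f x - f' x| ≤ ν) (hB : ∀ x, |f' x| ≤ B) (x : EuclideanSpace ℝ (Fin d)) :
    |gaussianSmoothing f' t x - f x| ≤ ν + L₁ * t ^ 2 * d := by
  have i1 : Integrable (fun u => f' (x + t • u)) (stdGaussian (EuclideanSpace ℝ (Fin d))) :=
    (integrable_const B).mono' (hf'.comp (by fun_prop)).aestronglyMeasurable
      (ae_of_all _ fun u => hB _)
  have i2 : Integrable (fun u => t * ⟪gradient f x, u⟫)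
      (stdGaussian (EuclideanSpace ℝ (Fin d))) := by
    simpa using (integrable_inner_pow_stdGaussian (gradient f x) 1).const_mul t
  have z : ∫ u, t * ⟪gradient f x, u⟫ ∂(stdGaussian (EuclideanSpace ℝ (Fin d))) = 0 := by
    rw [integral_const_mul]
    have := integral_strongDual_stdGaussian (innerSL ℝ (gradient f x))
    simp only [innerSL_apply_apply ℝ] at this
    rw [this, mul_zero]
  have e : gaussianSmoothing f' t x - f x =
      ∫ u, (f' (x + t • u) - f x - t * ⟪gradient f x, u⟫)
        ∂(stdGaussian (EuclideanSpace ℝ (Fin d))) := by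
    have i12 : Integrable (fun u => f' (x + t • u) - f x)
      (stdGaussian (EuclideanSpace ℝ (Fin d))) := i1.sub (integrable_const _)
    rw [integral_sub i12 i2, z,
      integral_sub i1 (integrable_const _)]
    simp [gaussianSmoothing]
  have i3 : Integrable (fun u => ν + L₁ * t ^ 2 * ‖u‖ ^ 2)
      (stdGaussian (EuclideanSpace ℝ (Fin d))) :=
    (integrable_const _).add ((integrable_norm_pow_stdGaussian 2).const_mul _)
  rw [e, ← Real.norm_eq_abs]
  refine (norm_integral_le_of_norm_le i3 (ae_of_all _ fun u => ?_)).trans (le_of_eq ?_)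
  · have h := hf.abs_sub_sub_inner_le hL₁ x (x + t • u)
    rw [add_sub_cancel_left, inner_smul_right, norm_smul, mul_pow, Real.norm_eq_abs, sq_abs] at h
    have h2 := hν (x + t • u)
    rw [Real.norm_eq_abs]
    rw [abs_le] at *
    constructor <;> linarith [h.1, h.2, h2.1, h2.2]
  · rw [integral_add (integrable_const _) ((integrable_norm_pow_stdGaussian 2).const_mul _),
      integral_const_mul, integral_norm_sq_stdGaussian]
    simp

lemma integral_step_le (hd : 1 ≤ d) {f f' : EuclideanSpace ℝ (Fin d) → ℝ} {L L₁ ν t B : ℝ}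
    (hL₁ : 0 ≤ L₁) (hf : IsSmoothWith L₁ f) (hf' : Measurable f')
    (hν : ∀ x, |f x - f' x| ≤ ν) (hB : ∀ x, |f x| ≤ B) (hB' : ∀ x, |f' x| ≤ B) (ht : 0 < t)
    (hL : 0 < L) (hs : IsSmoothWith L (gaussianSmoothing f' t))
    (x : EuclideanSpace ℝ (Fin d)) :
    ∫ u, f (x - (1 / (16 * ((d : ℝ) + 4) * L)) • zoGradient f' x t u)
      ∂(stdGaussian (EuclideanSpace ℝ (Fin d))) ≤
    f x + 2 * ν + 2 * L₁ * t ^ 2 * d - (1 / (16 * ((d : ℝ) + 4) * L)) / 8 * ‖gradient f x‖ ^ 2 +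
      2 * (1 / (16 * ((d : ℝ) + 4) * L)) * (8 * ν ^ 2 / t ^ 2 * d + 30 * L₁ ^ 2 * t ^ 2 * d ^ 3) := by
  have hd' : (1 : ℝ) ≤ d := by exact_mod_cast hd
  set γ := stdGaussian (EuclideanSpace ℝ (Fin d))
  set β := 1 / (16 * ((d : ℝ) + 4) * L) with hβ
  have hβ0 : 0 < β := by positivity
  set h := gaussianSmoothing f' t
  set G := gradient h x with hG
  set a := gradient f x
  have i1 := integrable_zoGradient hf' hB' x t
  have i2 := integrable_norm_zoGradient_sq hL₁ hf hf' hν ht x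
  have i1' : Integrable (fun u => β * ⟪G, zoGradient f' x t u⟫) γ := (i1.const_inner G).const_mul β
  have hfm : Measurable f := hf.differentiable.continuous.measurable
  have hzm := measurable_zoGradient hf' (measurable_const (a := x))
    (measurable_const (a := t)) measurable_id
  have i0 : Integrable (fun u => f (x - β • zoGradient f' x t u)) γ :=
    (integrable_const B).mono' (hfm.comp (by fun_prop)).aestronglyMeasurable
      (ae_of_all _ fun u => hB _)
  -- The descent inequality for the smoothed function, with the comparison to `f` used at both
  -- endpoints.
  have hpt : ∀ u, f (x - β • zoGradient f' x t u) ≤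
      (f x + 2 * ν + 2 * L₁ * t ^ 2 * d) - β * ⟪G, zoGradient f' x t u⟫ +
        L * β ^ 2 * ‖zoGradient f' x t u‖ ^ 2 := by
    intro u
    have q := (abs_le.1 (hs.abs_sub_sub_inner_le hL.le x (x - β • zoGradient f' x t u))).2
    rw [sub_sub_cancel_left, inner_neg_right, norm_neg, inner_smul_right, norm_smul, mul_pow,
      Real.norm_of_nonneg hβ0.le] at q
    have s1 := (abs_le.1 (abs_gaussianSmoothing_sub_le (t := t) hL₁ hf hf' hν hB' x)).2
    have s2 := (abs_le.1 (abs_gaussianSmoothing_sub_le (t := t) hL₁ hf hf' hν hB'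
      (x - β • zoGradient f' x t u))).1
    simp only [h, G] at *
    linarith
  have i3 : Integrable (fun u => (f x + 2 * ν + 2 * L₁ * t ^ 2 * d) -
      β * ⟪G, zoGradient f' x t u⟫) γ := (integrable_const _).sub i1'
  have i4 : Integrable (fun u => L * β ^ 2 * ‖zoGradient f' x t u‖ ^ 2) γ := i2.const_mul _
  have i5 : Integrable (fun u => (f x + 2 * ν + 2 * L₁ * t ^ 2 * d) -
      β * ⟪G, zoGradient f' x t u⟫ + L * β ^ 2 * ‖zoGradient f' x t u‖ ^ 2) γ := i3.add i4
  have hint := integral_mono i0 i5 hpt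
  rw [integral_add i3 i4, integral_sub (integrable_const _) i1', integral_const_mul,
    integral_const_mul,
    integral_inner i1, integral_zoGradient hf' hB' ht x, real_inner_self_eq_norm_sq] at hint
  simp only [integral_const, probReal_univ, one_smul] at hint
  have hS := integral_norm_zoGradient_sq_le hd hL₁ hf hf' hν ht x
  have hD := norm_gradient_gaussianSmoothing_sub_sq_le hL₁ hf hf' hν hB' ht x
  have hR := integral_differenceError_sq_le hL₁ hf hf' hν ht x
  set R := ∫ u, differenceError f f' x t u ^ 2 * ‖u‖ ^ 2 ∂γ
  set S := ∫ u, ‖zoGradient f' x t u‖ ^ 2 ∂γ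
  have hR0 : 0 ≤ R := integral_nonneg fun u => by positivity
  have hGa : ‖a‖ ^ 2 ≤ 2 * ‖G‖ ^ 2 + 2 * R := by
    have t1 : ‖a‖ ≤ ‖G‖ + ‖G - a‖ := by
      have := norm_sub_le G (G - a)
      rwa [sub_sub_cancel] at this
    have t2 : ‖a‖ ^ 2 ≤ (‖G‖ + ‖G - a‖) ^ 2 := by gcongr
    have t3 : (‖G‖ + ‖G - a‖) ^ 2 ≤ 2 * (‖G‖ ^ 2 + ‖G - a‖ ^ 2) := add_sq_le
    have t4 : ‖G - a‖ ^ 2 ≤ R := hD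
    linarith
  have hLβ : L * β ^ 2 = β * (1 / (16 * ((d : ℝ) + 4))) := by
    rw [hβ]
    field_simp
  -- Here `6 d / (16 (d + 4)) ≤ 3 / 8`. Since `hGa` gives `β ‖G‖² ≥ β ‖a‖² / 2 - β R`, the net
  -- decrease is `(1/2 - 3/8) β ‖a‖²`, at the cost of `2 β R`.
  have hS2 : L * β ^ 2 * S ≤ β * (3 / 8 * ‖a‖ ^ 2 + R) := by
    rw [hLβ, mul_assoc]
    refine mul_le_mul_of_nonneg_left ?_ hβ0.le
    rw [one_div, inv_mul_le_iff₀ (by positivity)]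
    refine hS.trans ?_
    have : 0 ≤ ‖a‖ ^ 2 := by positivity
    nlinarith
  have e1 : β * ‖a‖ ^ 2 ≤ β * (2 * ‖G‖ ^ 2 + 2 * R) := by gcongr
  have e2 : β * R ≤ β * (8 * ν ^ 2 / t ^ 2 * d + 30 * L₁ ^ 2 * t ^ 2 * d ^ 3) := by gcongr
  have hint' : ∫ u, f (x - β • zoGradient f' x t u) ∂γ ≤
      (f x + 2 * ν + 2 * L₁ * t ^ 2 * d) - β * ‖G‖ ^ 2 + L * β ^ 2 * S := hint
  linarith

/-- The expected decrease of the objective in one iteration. -/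
lemma sq_norm_gradient_le_step (hd : 1 ≤ d) {f f' : EuclideanSpace ℝ (Fin d) → ℝ}
    {L L₁ ℓ ν t B : ℝ} (hL₁ : 0 ≤ L₁) (hf : IsSmoothWith L₁ f) (hf' : Measurable f')
    (hν : ∀ x, |f x - f' x| ≤ ν) (hB : ∀ x, |f x| ≤ B) (hB' : ∀ x, |f' x| ≤ B) (ht : 0 < t)
    (hνt : ν ≤ t ^ 2) (hℓ : 0 < ℓ) (hℓL : ℓ ≤ L) (hL : L ≤ L₁ + 2 * ν / t ^ 2)
    (hs : IsSmoothWith L (gaussianSmoothing f' t)) (x : EuclideanSpace ℝ (Fin d)) :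
    1 / (640 * (L₁ + 2) * d) * ‖gradient f x‖ ^ 2 ≤
      f x - ∫ u, f (x - (1 / (16 * ((d : ℝ) + 4) * L)) • zoGradient f' x t u)
        ∂(stdGaussian (EuclideanSpace ℝ (Fin d))) +
      ((2 + 1 / ℓ) * ν + (2 * L₁ + 4 * L₁ ^ 2 / ℓ) * (d ^ 2 * t ^ 2)) := by
  have hd' : (1 : ℝ) ≤ d := by exact_mod_cast hd
  have hν0 : 0 ≤ ν := (abs_nonneg _).trans (hν 0)
  have h := integral_step_le hd hL₁ hf hf' hν hB hB' ht (hℓ.trans_le hℓL) hs x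
  set I := ∫ u, f (x - (1 / (16 * ((d : ℝ) + 4) * L)) • zoGradient f' x t u)
        ∂(stdGaussian (EuclideanSpace ℝ (Fin d)))
  have hL0 : 0 < L := hℓ.trans_le hℓL
  have hνt1 : ν / t ^ 2 ≤ 1 := (div_le_one (by positivity)).2 hνt
  have hL2 : L ≤ L₁ + 2 := by
    have : 2 * ν / t ^ 2 = 2 * (ν / t ^ 2) := by ring
    linarith
  -- The constant is `640 = 16 · 5 · 8`, from `d + 4 ≤ 5 d`.
  have b1 : 1 / (640 * (L₁ + 2) * d) ≤ (1 / (16 * ((d : ℝ) + 4) * L)) / 8 := by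
    rw [div_div]
    apply one_div_le_one_div_of_le (by positivity)
    calc 16 * ((d : ℝ) + 4) * L * 8 ≤ 16 * (d + 4 * d) * (L₁ + 2) * 8 := by gcongr; linarith
      _ = _ := by ring
  -- The lower bound `ℓ ≤ L` limits the step size to order `1 / d`, which cancels one factor `d` of
  -- the error; `ν ≤ t²` turns `ν² / t²` into `ν`.
  have b2 : 2 * (1 / (16 * ((d : ℝ) + 4) * L)) * (8 * ν ^ 2 / t ^ 2 * d + 30 * L₁ ^ 2 * t ^ 2 * d ^ 3)
      ≤ 1 / ℓ * ν + 4 * L₁ ^ 2 / ℓ * (d ^ 2 * t ^ 2) := by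
    calc _ ≤ 2 * (1 / (16 * (d : ℝ) * ℓ)) * (8 * ν * d + 30 * L₁ ^ 2 * t ^ 2 * d ^ 3) := by
          gcongr
          · linarith
          · rw [show 8 * ν ^ 2 / t ^ 2 = 8 * ν * (ν / t ^ 2) by ring]
            exact mul_le_of_le_one_right (by positivity) hνt1
      _ = 1 / ℓ * ν + (30 / 8) * L₁ ^ 2 / ℓ * (d ^ 2 * t ^ 2) := by
          field_simp
          ring
      _ ≤ _ := by
          gcongr
          norm_num
  have b3 : 2 * L₁ * t ^ 2 * d ≤ 2 * L₁ * (d ^ 2 * t ^ 2) := by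
    have : (d : ℝ) ≤ d ^ 2 := by nlinarith
    calc _ = 2 * L₁ * (d * t ^ 2) := by ring
      _ ≤ _ := by gcongr
  have b4 := mul_le_mul_of_nonneg_right b1 (sq_nonneg ‖gradient f x‖)
  linarith

end Step

/-! ### Integrating out an independent variable -/

section Independence

variable {Ω α β : Type*} [MeasurableSpace Ω] [MeasurableSpace α] [MeasurableSpace β]
  {P : Measure Ω} [IsProbabilityMeasure P]

/-- Fubini for the product law of `(Z, U)`. It replaces conditioning on the past, with `U` the new
sample, and later conditioning on the samples, with `U` the output index. -/
lemma integral_comp_prodMk_of_indepFun {Z : Ω → α} {U : Ω → β} {μ : Measure β}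
    (hZ : AEMeasurable Z P) (hU : HasLaw U μ P) (h : IndepFun Z U P)
    {φ : α → β → ℝ} (hφ : Measurable (Function.uncurry φ)) {B : ℝ} (hB : ∀ a b, |φ a b| ≤ B) :
    ∫ ω, φ (Z ω) (U ω) ∂P = ∫ ω, ∫ b, φ (Z ω) b ∂μ ∂P := by
  have hμ : IsProbabilityMeasure μ := by
    rw [← hU.map_eq]
    exact Measure.isProbabilityMeasure_map hU.aemeasurable
  have hZP : IsProbabilityMeasure (P.map Z) := Measure.isProbabilityMeasure_map hZ
  have e := (indepFun_iff_map_prod_eq_prod_map_map hZ hU.aemeasurable).1 h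
  rw [hU.map_eq] at e
  have h1 := integral_map (hZ.prodMk hU.aemeasurable) (f := Function.uncurry φ)
    hφ.aestronglyMeasurable
  have h2 := integral_map hZ (f := fun a => ∫ b, φ a b ∂μ)
    (StronglyMeasurable.integral_prod_right hφ.stronglyMeasurable).aestronglyMeasurable
  rw [← h2]
  simp only [Function.uncurry] at h1
  rw [← h1, e]
  exact integral_prod (Function.uncurry φ)
    ((integrable_const B).mono' hφ.aestronglyMeasurable (ae_of_all _ fun p => hB _ _))

lemma integral_uniformOn_Icc (m n : ℕ) (g : ℕ → ℝ) :
    ∫ k, g k ∂(uniformOn (Set.Icc (m + 1) n)) =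
      ((n - m : ℕ) : ℝ)⁻¹ * ∑ k ∈ Finset.Icc (m + 1) n, g k := by
  rw [uniformOn, ProbabilityTheory.cond, integral_smul_measure, ← Finset.coe_Icc,
    Measure.count_apply_finset, setIntegral_finset]
  · simp only [Nat.card_Icc, Nat.add_sub_add_right, ENNReal.toReal_inv, ENNReal.toReal_natCast,
      smul_eq_mul, Measure.real, Measure.count_singleton, ENNReal.toReal_one, one_mul]
  · rw [← Set.biUnion_of_singleton (↑(Finset.Icc (m + 1) n) : Set ℕ)]
    exact (integrableOn_finset_iUnion (s := Finset.Icc (m + 1) n)).2 fun k _ =>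
      integrableOn_singleton (by simp) (by simp)

end Independence

/-! ### Bounds along the iterates -/

section Iterates

variable {d : ℕ}

lemma sqrt_le_nextSmoothing (rule : SmoothingRule) (f' : EuclideanSpace ℝ (Fin d) → ℝ)
    (η γ ν : ℝ) (x : EuclideanSpace ℝ (Fin d)) (t : ℝ) (v : EuclideanSpace ℝ (Fin d)) :
    Real.sqrt ν ≤ nextSmoothing rule f' η γ ν x t v := by
  cases rule <;> exact le_max_right _ _

lemma nextSmoothing_le (rule : SmoothingRule) (f' : EuclideanSpace ℝ (Fin d) → ℝ)
    (η γ ν : ℝ) (x : EuclideanSpace ℝ (Fin d)) (t : ℝ) (v : EuclideanSpace ℝ (Fin d)) :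
    nextSmoothing rule f' η γ ν x t v ≤ max (γ * t) (Real.sqrt ν) := by
  cases rule
  · exact le_rfl
  · exact max_le_max (min_le_right _ _) le_rfl

lemma nextSmoothing_pos {rule : SmoothingRule} {f' : EuclideanSpace ℝ (Fin d) → ℝ}
    {η γ ν t : ℝ} (hrule : rule = SmoothingRule.derivative → 0 < ν) (hγ : 0 < γ) (ht : 0 < t)
    (x v : EuclideanSpace ℝ (Fin d)) : 0 < nextSmoothing rule f' η γ ν x t v := by
  cases rule
  · exact lt_max_of_lt_left (by positivity)
  · exact lt_max_of_lt_right (Real.sqrt_pos.2 (hrule rfl))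

lemma measurable_nextSmoothing (rule : SmoothingRule) {f' : EuclideanSpace ℝ (Fin d) → ℝ}
    (hf' : Measurable f') (η γ ν : ℝ) {α : Type*} [MeasurableSpace α]
    {x v : α → EuclideanSpace ℝ (Fin d)} {t : α → ℝ}
    (hx : Measurable x) (ht : Measurable t) (hv : Measurable v) :
    Measurable fun a => nextSmoothing rule f' η γ ν (x a) (t a) (v a) := by
  cases rule
  · simp only [nextSmoothing]
    fun_prop
  · simp only [nextSmoothing, zoDerivative]
    fun_prop

lemma measurable_zoslgh (rule : SmoothingRule) {f' : EuclideanSpace ℝ (Fin d) → ℝ}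
    (hf' : Measurable f') {L : ℝ → ℝ} (hL : Measurable L) (η γ ν : ℝ)
    (x₁ : EuclideanSpace ℝ (Fin d)) (t₁ : ℝ) (k : ℕ) :
    Measurable fun p : (ℕ → EuclideanSpace ℝ (Fin d)) × (ℕ → EuclideanSpace ℝ (Fin d)) =>
      zoslgh rule f' L η γ ν x₁ t₁ p.1 p.2 k := by
  have h1 : Measurable fun p : (ℕ → EuclideanSpace ℝ (Fin d)) × (ℕ → EuclideanSpace ℝ (Fin d)) =>
      zoslgh rule f' L η γ ν x₁ t₁ p.1 p.2 1 := by
    simp only [zoslgh]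
    exact measurable_const
  cases k with
  | zero =>
    simp only [zoslgh]
    exact measurable_const
  | succ k =>
    induction k with
    | zero => exact h1
    | succ k ih =>
      simp only [zoslgh]
      refine Measurable.prodMk ?_ ?_
      · have hβ : Measurable fun p : (ℕ → EuclideanSpace ℝ (Fin d)) × (ℕ → EuclideanSpace ℝ (Fin d)) =>
            1 / (16 * ((d : ℝ) + 4) * L (zoslgh rule f' L η γ ν x₁ t₁ p.1 p.2 (k + 1)).2) :=
          measurable_const.div (measurable_const.mul (hL.comp ih.snd))
        exact ih.fst.sub (hβ.smul (measurable_zoGradient hf' ih.fst ih.snd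
          ((measurable_pi_apply (k + 1)).comp measurable_fst)))
      · exact measurable_nextSmoothing rule hf' η γ ν ih.fst ih.snd
          ((measurable_pi_apply (k + 1)).comp measurable_snd)

lemma zoslgh_congr (rule : SmoothingRule) (f' : EuclideanSpace ℝ (Fin d) → ℝ) (L : ℝ → ℝ)
    (η γ ν : ℝ) (x₁ : EuclideanSpace ℝ (Fin d)) (t₁ : ℝ)
    {u u' v v' : ℕ → EuclideanSpace ℝ (Fin d)} {k : ℕ} (hu : ∀ j < k, u j = u' j)
    (hv : ∀ j < k, v j = v' j) :
    zoslgh rule f' L η γ ν x₁ t₁ u v k = zoslgh rule f' L η γ ν x₁ t₁ u' v' k := by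
  cases k with
  | zero => simp only [zoslgh]
  | succ k =>
    induction k with
    | zero => simp only [zoslgh]
    | succ k ih =>
      simp only [zoslgh, ih (fun j hj => hu j (by omega)) (fun j hj => hv j (by omega)),
        hu (k + 1) (by omega), hv (k + 1) (by omega)]

/-- Before the clamp at `√ν`, either rule shrinks `t` at least by the factor `γ`. The bounds hold
for every realisation, whatever the derivative estimate is. -/
lemma zoslgh_smoothing_bounds {rule : SmoothingRule} {f' : EuclideanSpace ℝ (Fin d) → ℝ}
    {L : ℝ → ℝ} {η γ γbar ν t₁ : ℝ} {x₁ : EuclideanSpace ℝ (Fin d)}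
    (hrule : rule = SmoothingRule.derivative → 0 < ν) (hγ : 0 < γ) (hγbar : γ ≤ γbar)
    (hγ1 : γbar < 1) (ht₁ : 0 < t₁) (hν : Real.sqrt ν ≤ t₁)
    (u v : ℕ → EuclideanSpace ℝ (Fin d)) (k : ℕ) :
    0 < (zoslgh rule f' L η γ ν x₁ t₁ u v (k + 1)).2 ∧
    Real.sqrt ν ≤ (zoslgh rule f' L η γ ν x₁ t₁ u v (k + 1)).2 ∧
    (zoslgh rule f' L η γ ν x₁ t₁ u v (k + 1)).2 ≤ max (γbar ^ k * t₁) (Real.sqrt ν) := by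
  induction k with
  | zero => simp [zoslgh, ht₁, hν]
  | succ k ih =>
    simp only [zoslgh]
    refine ⟨nextSmoothing_pos hrule hγ ih.1 _ _, sqrt_le_nextSmoothing _ _ _ _ _ _ _ _, ?_⟩
    refine (nextSmoothing_le _ _ _ _ _ _ _ _).trans (max_le ?_ (le_max_right _ _))
    have hγbar0 : 0 < γbar := hγ.trans_le hγbar
    rcases le_max_iff.1 ih.2.2 with h | h
    · refine le_max_of_le_left ?_
      calc _ ≤ γbar * (γbar ^ k * t₁) := by
            gcongr
            exact ih.1.le
        _ = _ := by ring
    · refine le_max_of_le_right ?_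
      calc _ ≤ 1 * Real.sqrt ν :=
            mul_le_mul (hγbar.trans hγ1.le) h ih.1.le zero_le_one
        _ = _ := one_mul _

/-- The `k`-th pair depends only on samples with index below `k`, a finite family disjoint from `u
k`. -/
lemma indepFun_zoslgh {Ω : Type*} [MeasurableSpace Ω] {P : Measure Ω}
    {u v : ℕ → Ω → EuclideanSpace ℝ (Fin d)}
    (hu : ∀ k, AEMeasurable (u k) P) (hv : ∀ k, AEMeasurable (v k) P)
    (hind : iIndepFun (Sum.elim u v : ℕ ⊕ ℕ → Ω → EuclideanSpace ℝ (Fin d)) P)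
    (rule : SmoothingRule) {f' : EuclideanSpace ℝ (Fin d) → ℝ}
    (hf' : Measurable f') {L : ℝ → ℝ} (hL : Measurable L) (η γ ν : ℝ)
    (x₁ : EuclideanSpace ℝ (Fin d)) (t₁ : ℝ) (k : ℕ) :
    IndepFun (fun ω => zoslgh rule f' L η γ ν x₁ t₁ (fun k => u k ω) (fun k => v k ω) k) (u k) P := by
  classical
  set S : Finset (ℕ ⊕ ℕ) := (Finset.range k).disjSum (Finset.range k) with hS
  set T : Finset (ℕ ⊕ ℕ) := {Sum.inl k} with hT
  have hST : Disjoint S T := by simp [hS, hT]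
  have h := hind.indepFun_finset₀ S T hST (by rintro (i | i); exacts [hu i, hv i])
  -- Extending the finite family by zero makes the iterate a function of it, since later samples do
  -- not enter.
  set ext : (S → EuclideanSpace ℝ (Fin d)) → ℕ ⊕ ℕ → EuclideanSpace ℝ (Fin d) :=
    fun w i => if hi : i ∈ S then w ⟨i, hi⟩ else 0 with hext
  have hextm : ∀ i, Measurable fun w => ext w i := by
    intro i
    by_cases hi : i ∈ S
    · simp only [hext, hi, dite_true]
      exact measurable_pi_apply _
    · simp only [hext, hi, dite_false]
      exact measurable_const
  have hpm : Measurable fun w : S → EuclideanSpace ℝ (Fin d) =>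
      ((fun k => ext w (Sum.inl k), fun k => ext w (Sum.inr k)) :
        (ℕ → EuclideanSpace ℝ (Fin d)) × (ℕ → EuclideanSpace ℝ (Fin d))) :=
    (measurable_pi_lambda _ fun j => hextm _).prodMk (measurable_pi_lambda _ fun j => hextm _)
  have h2 := h.comp ((measurable_zoslgh rule hf' hL η γ ν x₁ t₁ k).comp hpm)
    (measurable_pi_apply (⟨Sum.inl k, by simp [hT]⟩ : T))
  refine h2.congr (ae_of_all _ fun ω => ?_) (ae_of_all _ fun ω => rfl)
  refine zoslgh_congr _ _ _ _ _ _ _ _ (fun j hj => ?_) fun j hj => ?_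
  · simp [hext, hS, hj]
  · simp [hext, hS, hj]

variable {Ω : Type*} [MeasurableSpace Ω] {P : Measure Ω} [IsProbabilityMeasure P]

/-- The expected decrease of the objective in one iteration, along the iterates. -/
lemma integral_sq_norm_gradient_le_step (hd : 1 ≤ d) {f f' : EuclideanSpace ℝ (Fin d) → ℝ}
    {L₀ L₁ ℓ ν t₁ B η γ γbar : ℝ} {L : ℝ → ℝ} {rule : SmoothingRule}
    (hL₁ : 0 ≤ L₁) (hℓ : 0 < ℓ) (hf : IsSmoothWith L₁ f) (hf' : Measurable f')
    (hν : ∀ x, |f x - f' x| ≤ ν) (hB : ∀ x, |f x| ≤ B) (hB' : ∀ x, |f' x| ≤ B)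
    (hgrad : ∀ x, ‖gradient f x‖ ≤ L₀) (hLm : Measurable L)
    (hL : ∀ t ∈ Set.Ioc 0 (max t₁ (Real.sqrt ν)),
      IsSmoothWith (L t) (gaussianSmoothing f' t) ∧ ℓ ≤ L t ∧ L t ≤ L₁ + 2 * ν / t ^ 2)
    (hrule : rule = SmoothingRule.derivative → 0 < ν) (hγ : 0 < γ) (hγbar : γ ≤ γbar)
    (hγ1 : γbar < 1) (ht₁ : 0 < t₁) (hνt : Real.sqrt ν ≤ t₁) (x₁ : EuclideanSpace ℝ (Fin d))
    {u v : ℕ → Ω → EuclideanSpace ℝ (Fin d)}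
    (hu : ∀ k, HasLaw (u k) (stdGaussian (EuclideanSpace ℝ (Fin d))) P)
    (hv : ∀ k, HasLaw (v k) (stdGaussian (EuclideanSpace ℝ (Fin d))) P)
    (hind : iIndepFun (Sum.elim u v : ℕ ⊕ ℕ → Ω → EuclideanSpace ℝ (Fin d)) P) (k : ℕ) :
    1 / (640 * (L₁ + 2) * d) * ∫ ω, ‖gradient f (zoslgh rule f' L η γ ν x₁ t₁
        (fun k => u k ω) (fun k => v k ω) (k + 1)).1‖ ^ 2 ∂P ≤
      ∫ ω, f (zoslgh rule f' L η γ ν x₁ t₁ (fun k => u k ω) (fun k => v k ω) (k + 1)).1 ∂P -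
      ∫ ω, f (zoslgh rule f' L η γ ν x₁ t₁ (fun k => u k ω) (fun k => v k ω) (k + 2)).1 ∂P +
      ((2 + 1 / ℓ) * ν + (2 * L₁ + 4 * L₁ ^ 2 / ℓ) * (d ^ 2 * ((γbar ^ k * t₁) ^ 2 + ν))) := by
  have hν0 : 0 ≤ ν := (abs_nonneg _).trans (hν 0)
  set Z : Ω → EuclideanSpace ℝ (Fin d) × ℝ := fun ω =>
    zoslgh rule f' L η γ ν x₁ t₁ (fun k => u k ω) (fun k => v k ω) (k + 1) with hZ
  have hWm : AEMeasurable (fun ω => ((fun k => u k ω, fun k => v k ω) :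
      (ℕ → EuclideanSpace ℝ (Fin d)) × (ℕ → EuclideanSpace ℝ (Fin d)))) P :=
    (aemeasurable_pi_lambda _ fun k => (hu k).aemeasurable).prodMk
      (aemeasurable_pi_lambda _ fun k => (hv k).aemeasurable)
  have hZm : AEMeasurable Z P :=
    (measurable_zoslgh rule hf' hLm η γ ν x₁ t₁ (k + 1)).comp_aemeasurable hWm
  have hZu : IndepFun Z (u (k + 1)) P :=
    indepFun_zoslgh (fun k => (hu k).aemeasurable) (fun k => (hv k).aemeasurable) hind rule hf' hLm
      η γ ν x₁ t₁ (k + 1)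
  have hfm : Measurable f := hf.differentiable.continuous.measurable
  have hgm : Measurable (gradient f) := hf.continuous_gradient.measurable
  set φ : EuclideanSpace ℝ (Fin d) × ℝ → EuclideanSpace ℝ (Fin d) → ℝ := fun z b =>
    f (z.1 - (1 / (16 * ((d : ℝ) + 4) * L z.2)) • zoGradient f' z.1 z.2 b) with hφ
  have hφm : Measurable (Function.uncurry φ) := by
    have hz : Measurable fun p : (EuclideanSpace ℝ (Fin d) × ℝ) × EuclideanSpace ℝ (Fin d) =>
        zoGradient f' p.1.1 p.1.2 p.2 :=
      measurable_zoGradient hf' measurable_fst.fst measurable_fst.snd measurable_snd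
    have hβ : Measurable fun p : (EuclideanSpace ℝ (Fin d) × ℝ) × EuclideanSpace ℝ (Fin d) =>
        1 / (16 * ((d : ℝ) + 4) * L p.1.2) := by fun_prop
    exact hfm.comp (measurable_fst.fst.sub (hβ.smul hz))
  have hstep : ∫ ω, f (zoslgh rule f' L η γ ν x₁ t₁ (fun k => u k ω) (fun k => v k ω) (k + 2)).1 ∂P
      = ∫ ω, ∫ b, φ (Z ω) b ∂(stdGaussian (EuclideanSpace ℝ (Fin d))) ∂P := by
    rw [← integral_comp_prodMk_of_indepFun hZm (hu (k + 1)) hZu hφm fun z b => hB _]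
    simp only [zoslgh, hφ, hZ]
  rw [hstep]
  set C := (2 + 1 / ℓ) * ν + (2 * L₁ + 4 * L₁ ^ 2 / ℓ) * (d ^ 2 * ((γbar ^ k * t₁) ^ 2 + ν))
  have i1 : Integrable (fun ω => ‖gradient f (Z ω).1‖ ^ 2) P := by
    refine (integrable_const (L₀ ^ 2)).mono'
      ((hgm.comp_aemeasurable hZm.fst).norm.pow_const 2).aestronglyMeasurable
      (ae_of_all _ fun ω => ?_)
    rw [Real.norm_of_nonneg (by positivity)]
    exact pow_le_pow_left₀ (norm_nonneg _) (hgrad _) 2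
  have i2 : Integrable (fun ω => f (Z ω).1) P :=
    (integrable_const B).mono' (hfm.comp_aemeasurable hZm.fst).aestronglyMeasurable
      (ae_of_all _ fun ω => hB _)
  have i3 : Integrable (fun ω => ∫ b, φ (Z ω) b ∂(stdGaussian (EuclideanSpace ℝ (Fin d)))) P := by
    refine (integrable_const B).mono'
      (((StronglyMeasurable.integral_prod_right hφm.stronglyMeasurable).measurable).comp_aemeasurable
        hZm).aestronglyMeasurable (ae_of_all _ fun ω => ?_)
    refine (norm_integral_le_of_norm_le_const (C := B) (ae_of_all _ fun b => hB _)).trans ?_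
    simp
  have i23 : Integrable (fun ω => f (Z ω).1 -
      ∫ b, φ (Z ω) b ∂(stdGaussian (EuclideanSpace ℝ (Fin d)))) P := i2.sub i3
  have i4 : Integrable (fun ω => f (Z ω).1 -
      ∫ b, φ (Z ω) b ∂(stdGaussian (EuclideanSpace ℝ (Fin d))) + C) P :=
    i23.add (integrable_const C)
  have hmono := integral_mono (i1.const_mul (1 / (640 * (L₁ + 2) * d))) i4 fun ω => by
    obtain ⟨b1, b2, b3⟩ := zoslgh_smoothing_bounds (f' := f') (L := L) (η := η) (x₁ := x₁)
      hrule hγ hγbar hγ1 ht₁ hνt (fun k => u k ω) (fun k => v k ω) k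
    have hνZ : ν ≤ (Z ω).2 ^ 2 := (Real.sqrt_le_left b1.le).1 b2
    have hγbar0 : 0 < γbar := hγ.trans_le hγbar
    have hZt : (Z ω).2 ≤ max t₁ (Real.sqrt ν) := by
      refine b3.trans (max_le_max ?_ le_rfl)
      exact mul_le_of_le_one_left ht₁.le (pow_le_one₀ hγbar0.le hγ1.le)
    -- The maximum is replaced by a sum, so that the total error splits into a geometric series and
    -- a constant floor.
    have hZ2 : (Z ω).2 ^ 2 ≤ (γbar ^ k * t₁) ^ 2 + ν := by
      rcases le_max_iff.1 b3 with h | h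
      · have := pow_le_pow_left₀ b1.le h 2
        linarith
      · have := pow_le_pow_left₀ b1.le h 2
        rw [Real.sq_sqrt hν0] at this
        have h0 := sq_nonneg (γbar ^ k * t₁)
        linarith
    obtain ⟨l1, l2, l3⟩ := hL (Z ω).2 ⟨b1, hZt⟩
    have := sq_norm_gradient_le_step hd hL₁ hf hf' hν hB hB' b1 hνZ hℓ l2 l3 l1 (Z ω).1
    refine this.trans ?_
    simp only [C]
    gcongr
  rw [integral_const_mul, integral_add i23 (integrable_const _), integral_sub i2 i3] at hmono
  simpa using hmono

/-- The expected squared gradient norms, summed over the iterations `m + 1, …, m + n`. -/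
lemma sum_integral_sq_norm_gradient_le (hd : 1 ≤ d) {f f' : EuclideanSpace ℝ (Fin d) → ℝ}
    {L₀ L₁ ℓ ν t₁ B η γ γbar fstar : ℝ} {L : ℝ → ℝ} {rule : SmoothingRule}
    (hL₁ : 0 ≤ L₁) (hℓ : 0 < ℓ) (hf : IsSmoothWith L₁ f) (hf' : Measurable f')
    (hν : ∀ x, |f x - f' x| ≤ ν) (hB : ∀ x, |f x| ≤ B) (hB' : ∀ x, |f' x| ≤ B)
    (hgrad : ∀ x, ‖gradient f x‖ ≤ L₀) (hfstar : ∀ x, fstar ≤ f x) (hLm : Measurable L)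
    (hL : ∀ t ∈ Set.Ioc 0 (max t₁ (Real.sqrt ν)),
      IsSmoothWith (L t) (gaussianSmoothing f' t) ∧ ℓ ≤ L t ∧ L t ≤ L₁ + 2 * ν / t ^ 2)
    (hrule : rule = SmoothingRule.derivative → 0 < ν) (hγ : 0 < γ) (hγbar : γ ≤ γbar)
    (hγ1 : γbar < 1) (ht₁ : 0 < t₁) (hνt : Real.sqrt ν ≤ t₁) (x₁ : EuclideanSpace ℝ (Fin d))
    {u v : ℕ → Ω → EuclideanSpace ℝ (Fin d)}
    (hu : ∀ k, HasLaw (u k) (stdGaussian (EuclideanSpace ℝ (Fin d))) P)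
    (hv : ∀ k, HasLaw (v k) (stdGaussian (EuclideanSpace ℝ (Fin d))) P)
    (hind : iIndepFun (Sum.elim u v : ℕ ⊕ ℕ → Ω → EuclideanSpace ℝ (Fin d)) P) (m n : ℕ) {Δ : ℝ}
    (hΔ : ∀ ω, f (zoslgh rule f' L η γ ν x₁ t₁ (fun k => u k ω) (fun k => v k ω) (m + 1)).1 - fstar
      ≤ Δ) :
    ∑ k ∈ Finset.range n, ∫ ω, ‖gradient f (zoslgh rule f' L η γ ν x₁ t₁
        (fun k => u k ω) (fun k => v k ω) (m + k + 1)).1‖ ^ 2 ∂P ≤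
      640 * (L₁ + 2) * d * (Δ + (2 * L₁ + 4 * L₁ ^ 2 / ℓ) *
          (d ^ 2 * (γbar ^ (2 * m) * t₁ ^ 2 / (1 - γbar ^ 2))) +
        n * ((2 + 1 / ℓ + 2 * L₁ + 4 * L₁ ^ 2 / ℓ) * (d ^ 2 * ν))) := by
  have hd' : (1 : ℝ) ≤ d := by exact_mod_cast hd
  have hν0 : 0 ≤ ν := (abs_nonneg _).trans (hν 0)
  have hγbar0 : 0 < γbar := hγ.trans_le hγbar
  set x : ℕ → Ω → EuclideanSpace ℝ (Fin d) := fun k ω =>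
    (zoslgh rule f' L η γ ν x₁ t₁ (fun k => u k ω) (fun k => v k ω) k).1 with hx
  set C₁ := 2 + 1 / ℓ
  set C₂ := 2 * L₁ + 4 * L₁ ^ 2 / ℓ
  have hC₁ : 0 ≤ C₁ := by positivity
  have hC₂ : 0 ≤ C₂ := by positivity
  have hstep : ∀ k, 1 / (640 * (L₁ + 2) * d) * ∫ ω, ‖gradient f (x (k + 1) ω)‖ ^ 2 ∂P ≤
      ∫ ω, f (x (k + 1) ω) ∂P - ∫ ω, f (x (k + 2) ω) ∂P +
        (C₁ * ν + C₂ * (d ^ 2 * ((γbar ^ k * t₁) ^ 2 + ν))) :=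
    integral_sq_norm_gradient_le_step hd hL₁ hℓ hf hf' hν hB hB' hgrad hLm hL hrule hγ hγbar
      hγ1 ht₁ hνt x₁ hu hv hind
  -- The expectations of `f` telescope, by induction on the number of terms.
  have hsum : ∀ n : ℕ, 1 / (640 * (L₁ + 2) * d) *
      ∑ k ∈ Finset.range n, ∫ ω, ‖gradient f (x (m + k + 1) ω)‖ ^ 2 ∂P ≤
      ∫ ω, f (x (m + 1) ω) ∂P - ∫ ω, f (x (m + n + 1) ω) ∂P +
        C₂ * (d ^ 2 * (γbar ^ (2 * m) * t₁ ^ 2)) * ∑ k ∈ Finset.range n, (γbar ^ 2) ^ k +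
        n * (C₁ * ν + C₂ * (d ^ 2 * ν)) := by
    intro n
    induction n with
    | zero => simp
    | succ n ih =>
      rw [Finset.sum_range_succ, Finset.sum_range_succ, mul_add]
      have h := hstep (m + n)
      have e : (γbar ^ (m + n) * t₁) ^ 2 = γbar ^ (2 * m) * t₁ ^ 2 * (γbar ^ 2) ^ n := by
        rw [pow_add, pow_mul' γbar 2 m, mul_pow, mul_pow, ← pow_mul γbar n 2, mul_comm n 2,
          pow_mul γbar 2 n]
        ring
      rw [e] at h
      rw [show m + (n + 1) + 1 = m + n + 2 by ring]
      push_cast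
      linarith
  have hfm : Measurable f := hf.differentiable.continuous.measurable
  have hWm : AEMeasurable (fun ω => ((fun k => u k ω, fun k => v k ω) :
      (ℕ → EuclideanSpace ℝ (Fin d)) × (ℕ → EuclideanSpace ℝ (Fin d)))) P :=
    (aemeasurable_pi_lambda _ fun k => (hu k).aemeasurable).prodMk
      (aemeasurable_pi_lambda _ fun k => (hv k).aemeasurable)
  have hi : ∀ k, Integrable (fun ω => f (x k ω)) P := fun k =>
    (integrable_const B).mono' (hfm.comp_aemeasurable
      ((measurable_zoslgh rule hf' hLm η γ ν x₁ t₁ k).comp_aemeasurable hWm).fst).aestronglyMeasurable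
      (ae_of_all _ fun ω => hB _)
  have e1 : ∫ ω, f (x (m + 1) ω) ∂P ≤ Δ + fstar := by
    have := integral_mono (hi (m + 1)) (integrable_const (Δ + fstar))
      fun ω => by have := hΔ ω; simp only [hx]; linarith
    simpa using this
  have e2 : fstar ≤ ∫ ω, f (x (m + n + 1) ω) ∂P := by
    have := integral_mono (integrable_const fstar) (hi (m + n + 1)) fun ω => hfstar _
    simpa using this
  have hγ2 : γbar ^ 2 < 1 := pow_lt_one₀ hγbar0.le hγ1 two_ne_zero
  have e3 : ∑ k ∈ Finset.range n, (γbar ^ 2) ^ k ≤ 1 / (1 - γbar ^ 2) := by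
    have h1 := geom_sum_mul_neg (γbar ^ 2) n
    rw [le_div_iff₀ (by linarith), h1]
    have : 0 ≤ (γbar ^ 2) ^ n := by positivity
    linarith
  have e4 : C₁ * ν ≤ C₁ * (d ^ 2 * ν) := by
    gcongr
    exact le_mul_of_one_le_left hν0 (one_le_pow₀ hd')
  have h := hsum n
  rw [one_div, inv_mul_le_iff₀ (by positivity)] at h
  refine h.trans ?_
  refine mul_le_mul_of_nonneg_left ?_ (by positivity)
  have e5 : C₂ * (d ^ 2 * (γbar ^ (2 * m) * t₁ ^ 2)) * ∑ k ∈ Finset.range n, (γbar ^ 2) ^ k ≤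
      C₂ * (d ^ 2 * (γbar ^ (2 * m) * t₁ ^ 2)) * (1 / (1 - γbar ^ 2)) := by gcongr
  have e6 : (n : ℝ) * (C₁ * ν + C₂ * (d ^ 2 * ν)) ≤
      n * ((2 + 1 / ℓ + 2 * L₁ + 4 * L₁ ^ 2 / ℓ) * (d ^ 2 * ν)) := by
    gcongr
    have : (2 + 1 / ℓ + 2 * L₁ + 4 * L₁ ^ 2 / ℓ) = C₁ + C₂ := by ring
    rw [this, add_mul]
    linarith
  have e7 : C₂ * (d ^ 2 * (γbar ^ (2 * m) * t₁ ^ 2)) * (1 / (1 - γbar ^ 2)) =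
      C₂ * (d ^ 2 * (γbar ^ (2 * m) * t₁ ^ 2 / (1 - γbar ^ 2))) := by ring
  linarith

/-- The mean over a uniform random index is the average of the means. -/
lemma integral_uniform_index {k₀ T : ℕ} {u v : ℕ → Ω → EuclideanSpace ℝ (Fin d)}
    {κ : Ω → ℕ} (hrun : IsRunSampling P u v κ k₀ T)
    {Φ : ℕ → (ℕ → EuclideanSpace ℝ (Fin d)) × (ℕ → EuclideanSpace ℝ (Fin d)) → ℝ}
    (hΦ : ∀ k, Measurable (Φ k)) {B : ℝ} (hB : ∀ k w, |Φ k w| ≤ B) :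
    Integrable (fun ω => Φ (κ ω) (fun k => u k ω, fun k => v k ω)) P ∧
    ∫ ω, Φ (κ ω) (fun k => u k ω, fun k => v k ω) ∂P = ((T - k₀ : ℕ) : ℝ)⁻¹ *
      ∑ k ∈ Finset.Icc (k₀ + 1) T, ∫ ω, Φ k (fun k => u k ω, fun k => v k ω) ∂P := by
  set W : Ω → (ℕ → EuclideanSpace ℝ (Fin d)) × (ℕ → EuclideanSpace ℝ (Fin d)) :=
    fun ω => (fun k => u k ω, fun k => v k ω)
  have hWm : AEMeasurable W P :=
    (aemeasurable_pi_lambda _ fun k => (hrun.law_u k).aemeasurable).prodMk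
      (aemeasurable_pi_lambda _ fun k => (hrun.law_v k).aemeasurable)
  have hm : Measurable (Function.uncurry fun w k => Φ k w) :=
    measurable_from_prod_countable_left fun k => hΦ k
  refine ⟨(integrable_const B).mono' (hm.comp_aemeasurable
    (hWm.prodMk hrun.law_index.aemeasurable)).aestronglyMeasurable (ae_of_all _ fun ω => hB _ _), ?_⟩
  have := integral_comp_prodMk_of_indepFun hWm hrun.law_index hrun.indep_index.symm hm
    fun w k => hB k w
  rw [this]
  simp_rw [integral_uniformOn_Icc]
  rw [integral_const_mul, integral_finsetSum]
  exact fun k _ => (integrable_const B).mono' ((hΦ k).comp_aemeasurable hWm).aestronglyMeasurable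
    (ae_of_all _ fun ω => hB _ _)

end Iterates

/-! ### From summed squared gradients to the random output -/

section Output

variable {d : ℕ}

/-- At smoothing parameter `0` the expectation is `|f x|` itself. -/
lemma ObjectiveAssumptions.exists_abs_le {f : EuclideanSpace ℝ (Fin d) → ℝ}
    {fstar L₀ L₁ t₁ : ℝ} (h : ObjectiveAssumptions f fstar L₀ L₁ t₁) (ht₁ : 0 ≤ t₁) :
    ∃ B, ∀ x, |f x| ≤ B := by
  obtain ⟨B, hB⟩ := h.bounded 0 ⟨le_rfl, ht₁⟩
  refine ⟨B, fun x => ?_⟩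
  simpa using hB (Set.mem_range_self x)

lemma sum_Icc_le_sum_range {g : ℕ → ℝ} (hg : ∀ k, 0 ≤ g k) (m T : ℕ) :
    ∑ k ∈ Finset.Icc (m + 1) T, g k ≤ ∑ k ∈ Finset.range T, g (k + 1) := by
  rw [Finset.range_eq_Ico, Finset.sum_Ico_add' g 0 T 1]
  exact Finset.sum_le_sum_of_subset_of_nonneg (fun k hk => by simp at *; omega) fun k _ _ => hg k

/-- The output is `ε`-stationary if the squared gradient norms over the output range are at most
`ε²` on average. -/
lemma outputIsStationary_of_sum_le {f f' : EuclideanSpace ℝ (Fin d) → ℝ} {L₀ L₁ η γ ν t₁ ε : ℝ}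
    {L : ℝ → ℝ} {rule : SmoothingRule} {k₀ T : ℕ} (hf : IsSmoothWith L₁ f)
    (hgrad : ∀ x, ‖gradient f x‖ ≤ L₀) (hf' : Measurable f') (hL : Measurable L)
    (x₁ : EuclideanSpace ℝ (Fin d)) (hε : 0 < ε) (hT : k₀ < T)
    (H : ∀ (Ω : Type w) [MeasurableSpace Ω] (P : Measure Ω) [IsProbabilityMeasure P]
      (u v : ℕ → Ω → EuclideanSpace ℝ (Fin d)),
      (∀ k, HasLaw (u k) (stdGaussian (EuclideanSpace ℝ (Fin d))) P) →
      (∀ k, HasLaw (v k) (stdGaussian (EuclideanSpace ℝ (Fin d))) P) →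
      iIndepFun (Sum.elim u v : ℕ ⊕ ℕ → Ω → EuclideanSpace ℝ (Fin d)) P →
      ∑ k ∈ Finset.Icc (k₀ + 1) T, ∫ ω, ‖gradient f (zoslgh rule f' L η γ ν x₁ t₁
        (fun k => u k ω) (fun k => v k ω) k).1‖ ^ 2 ∂P ≤ ((T : ℝ) - k₀) * ε ^ 2) :
    OutputIsStationary.{w} f f' rule L η γ ν x₁ t₁ ε k₀ T := by
  refine ⟨hT, fun Ω _ P _ u v κ hrun => ?_⟩
  have hgm : Measurable (gradient f) := hf.continuous_gradient.measurable
  have hΦ : ∀ k, Measurable fun p : (ℕ → EuclideanSpace ℝ (Fin d)) ×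
      (ℕ → EuclideanSpace ℝ (Fin d)) =>
      ‖gradient f (zoslgh rule f' L η γ ν x₁ t₁ p.1 p.2 k).1‖ := fun k =>
    (hgm.comp (measurable_zoslgh rule hf' hL η γ ν x₁ t₁ k).fst).norm
  obtain ⟨i1, -⟩ := integral_uniform_index hrun hΦ (B := L₀) fun k w => by
    rw [abs_norm]
    exact hgrad _
  obtain ⟨i2, e2⟩ := integral_uniform_index hrun (fun k => (hΦ k).pow_const 2) (B := L₀ ^ 2)
    fun k w => by
      rw [abs_of_nonneg (by positivity)]
      exact pow_le_pow_left₀ (norm_nonneg _) (hgrad _) 2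
  refine ⟨i1, ?_⟩
  -- Jensen's inequality jointly over the samples and the index.
  have h := sq_integral_le_integral_sq i1 i2
  rw [e2] at h
  have hT' : (0 : ℝ) < (T : ℝ) - k₀ := by
    rw [sub_pos]
    exact_mod_cast hT
  have h3 : ((T - k₀ : ℕ) : ℝ)⁻¹ * ∑ k ∈ Finset.Icc (k₀ + 1) T,
      ∫ ω, ‖gradient f (zoslgh rule f' L η γ ν x₁ t₁
        (fun k => u k ω) (fun k => v k ω) k).1‖ ^ 2 ∂P ≤ ε ^ 2 := by
    rw [Nat.cast_sub hT.le, inv_mul_le_iff₀ hT']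
    exact H Ω P u v hrun.law_u hrun.law_v hrun.indep_uv
  exact le_of_sq_le_sq (h.trans h3) hε.le

/-- Every `K` iterations halve the power of `γbar`, and `d ≤ 2^d`. A burn-in of `K d` iterations
thus cancels the factor `d²` of the smoothing error, and it is short enough for a complexity linear
in `d`. -/
lemma sq_nat_mul_pow_le_one {γbar : ℝ} {K : ℕ} (hγ0 : 0 < γbar) (hK : γbar ^ K ≤ 1 / 2) (d : ℕ) :
    (d : ℝ) ^ 2 * γbar ^ (2 * (K * d)) ≤ 1 := by
  have h1 : γbar ^ (K * d) ≤ (1 / 2) ^ d := by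
    rw [pow_mul]
    gcongr
  have h2 : (d : ℝ) ≤ 2 ^ d := by exact_mod_cast Nat.lt_two_pow_self.le
  have h3 : (d : ℝ) * γbar ^ (K * d) ≤ 1 := by
    calc (d : ℝ) * γbar ^ (K * d) ≤ 2 ^ d * (1 / 2) ^ d := by gcongr
      _ = 1 := by rw [← mul_pow]; norm_num
  rw [pow_mul' γbar 2, ← mul_pow]
  exact pow_le_one₀ (by positivity) h3

end Output

/-! ### Choice of constants and the two complexities -/

theorem theoremC1
    (L₀ L₁ t₁ γbar ℓ a A B : ℝ) (hL₀ : 0 < L₀) (hL₁ : 0 < L₁) (ht₁ : 0 < t₁)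
    (hγbar : γbar < 1) (hℓ : 0 < ℓ) (ha : 0 < a) :
    -- `c` is the constant in `ν = O(ε²/d³)`; `C₁ Δ` and `C₂ M ω` are the constants in the two
    -- iteration complexities. They do not depend on anything that is introduced after them.
    ∃ (c : ℝ) (C₁ : ℝ → ℝ) (C₂ : ℝ → ℝ → ℝ), 0 < c ∧
      ∀ (d : ℕ), 1 ≤ d →
      ∀ (f f' : EuclideanSpace ℝ (Fin d) → ℝ) (fstar ν : ℝ),
        ObjectiveAssumptions f fstar L₀ L₁ t₁ →
        Measurable f' →
        (∀ x, |f x - f' x| ≤ ν) →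
        -- `L₁ + 2ν/t²` is a gradient Lipschitz constant of the smoothed inexact function
        (∀ t : ℝ, 0 < t → IsSmoothWith (L₁ + 2 * ν / t ^ 2) (gaussianSmoothing f' t)) ∧
        -- the algorithm, run with any gradient Lipschitz constants `L t` between `ℓ` and that one
        ∀ (L : ℝ → ℝ), Measurable L →
          (∀ t ∈ Set.Ioc 0 (max t₁ (Real.sqrt ν)),
            IsSmoothWith (L t) (gaussianSmoothing f' t) ∧ ℓ ≤ L t ∧ L t ≤ L₁ + 2 * ν / t ^ 2) →
        ∀ (rule : SmoothingRule), (rule = SmoothingRule.derivative → 0 < ν) →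
        ∀ (η γ ε : ℝ) (x₁ : EuclideanSpace ℝ (Fin d)),
          0 < γ → γ ≤ γbar → 0 < ε → ν ≤ c * ε ^ 2 / d ^ 3 →
        ∀ (k₁ k₂ : ℕ), a * (d / ε ^ 2) ≤ k₁ → k₁ ≤ A * (d / ε ^ 2) →
          k₂ ≤ B * Real.logb γ (1 / d) + 1 →
          (∀ Δ : ℝ, f x₁ - fstar ≤ Δ →
            ∀ T : ℕ, C₁ Δ * (d ^ 3 / ε ^ 2) ≤ T →
              OutputIsStationary.{w} f f' rule L η γ ν x₁ t₁ ε (min k₁ k₂) T) ∧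
          (∀ M ω : ℝ, (∀ x, f x - fstar ≤ M) → 0 < ω → γ ≤ (d : ℝ) ^ (-(ω * ε ^ 2 / d)) →
            ∀ T : ℕ, C₂ M ω * (d / ε ^ 2) ≤ T →
              OutputIsStationary.{w} f f' rule L η γ ν x₁ t₁ ε (min k₁ k₂) T) := by
  -- The sign of `γbar` is known only once some `γ` with `0 < γ ≤ γbar` is given, but `K` must be
  -- fixed before; for `γbar ≤ 0` the value `0` is a dummy.
  obtain ⟨K, hK⟩ : ∃ K : ℕ, 0 < γbar → γbar ^ K ≤ 1 / 2 := by
    by_cases h : 0 < γbar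
    · obtain ⟨K, hK⟩ := exists_pow_lt_of_lt_one (by norm_num : (0 : ℝ) < 1 / 2) hγbar
      exact ⟨K, fun _ => hK.le⟩
    · exact ⟨0, fun h' => absurd h' h⟩
  set D := 640 * (L₁ + 2)
  set C := 2 * L₁ + 4 * L₁ ^ 2 / ℓ
  set E := 2 + 1 / ℓ + 2 * L₁ + 4 * L₁ ^ 2 / ℓ
  set q := t₁ ^ 2 / (1 - γbar ^ 2) with hq
  have hD0 : 0 < D := by positivity
  have hC0 : 0 < C := by positivity
  have hE0 : 0 < E := by positivity
  -- The first entry of the minimum keeps the total noise below `T ε² / 8`; the second gives `√ν ≤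
  -- t₁` when `ε < L₀`. In the complexities, `4` multiplies the bound on the sum, `2 |A|` pays for
  -- the `k₀` discarded iterations, and `1` makes `k₀ < T` strict. The term `K L₀²` pays for the
  -- burn-in.
  refine ⟨min (1 / (8 * (D * E))) (t₁ ^ 2 / L₀ ^ 2),
    fun Δ => 4 * (D * (|Δ| + C * q)) + 2 * |A| + 1,
    fun M _ => 4 * (K * L₀ ^ 2 + D * (|M| + C * q)) + 2 * |A| + 1, by positivity, ?_⟩
  intro d hd f f' fstar ν hobj hf' hν
  obtain ⟨Bf, hBf⟩ := hobj.exists_abs_le ht₁.le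
  have hν0 : 0 ≤ ν := (abs_nonneg _).trans (hν 0)
  have hd' : (1 : ℝ) ≤ d := by exact_mod_cast hd
  refine ⟨fun t ht => isSmoothWith_gaussianSmoothing hL₀.le hobj.lipschitz hobj.smooth hBf hf' hν ht,
    ?_⟩
  intro L hLm hL rule hrule η γ ε x₁ hγ hγγ hε hνc k₁ k₂ _ hk₁ _
  have hγbar0 : 0 < γbar := hγ.trans_le hγγ
  have hγ2 : γbar ^ 2 < 1 := pow_lt_one₀ hγbar0.le hγbar two_ne_zero
  have hq0 : 0 < q := div_pos (by positivity) (by linarith)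
  have hgrad := norm_gradient_le_of_lipschitz hL₀.le hobj.lipschitz
  have hB : ∀ x, |f x| ≤ Bf + ν := fun x => (hBf x).trans (by linarith)
  have hB' : ∀ x, |f' x| ≤ Bf + ν := fun x => by
    have h1 := abs_le.1 (hν x)
    have h2 := abs_le.1 (hBf x)
    rw [abs_le]
    constructor <;> linarith [h1.1, h1.2, h2.1, h2.2]
  have hk₀ : ((min k₁ k₂ : ℕ) : ℝ) ≤ |A| * (d / ε ^ 2) := by
    calc ((min k₁ k₂ : ℕ) : ℝ) ≤ k₁ := by exact_mod_cast min_le_left _ _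
      _ ≤ A * (d / ε ^ 2) := hk₁
      _ ≤ _ := by gcongr; exact le_abs_self A
  set k₀ := min k₁ k₂
  -- It is enough to bound the sum over all iterations, and only for small `ε`.
  have key : ∀ (T : ℕ) (N : ℝ), 0 ≤ N → 4 * N + 2 * (|A| * (d / ε ^ 2) * ε ^ 2) + d ≤ T * ε ^ 2 →
      (ε < L₀ → Real.sqrt ν ≤ t₁ →
        ∀ (Ω : Type w) [MeasurableSpace Ω] (P : Measure Ω) [IsProbabilityMeasure P]
        (u v : ℕ → Ω → EuclideanSpace ℝ (Fin d)),
        (∀ k, HasLaw (u k) (stdGaussian (EuclideanSpace ℝ (Fin d))) P) →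
        (∀ k, HasLaw (v k) (stdGaussian (EuclideanSpace ℝ (Fin d))) P) →
        iIndepFun (Sum.elim u v : ℕ ⊕ ℕ → Ω → EuclideanSpace ℝ (Fin d)) P →
        ∑ k ∈ Finset.range T, ∫ ω, ‖gradient f (zoslgh rule f' L η γ ν x₁ t₁
          (fun k => u k ω) (fun k => v k ω) (k + 1)).1‖ ^ 2 ∂P ≤
          N + D * d * (T * (E * (d ^ 2 * ν)))) →
      OutputIsStationary.{w} f f' rule L η γ ν x₁ t₁ ε k₀ T := by
    intro T N hN hT H
    have hε2 : 0 < ε ^ 2 := by positivity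
    have hk₀ε : k₀ * ε ^ 2 ≤ |A| * (d / ε ^ 2) * ε ^ 2 := by gcongr
    have hkT : k₀ < T := by
      have h1 : (k₀ : ℝ) * ε ^ 2 < T * ε ^ 2 := by
        have : 0 ≤ (k₀ : ℝ) * ε ^ 2 := by positivity
        linarith
      exact_mod_cast lt_of_mul_lt_mul_right h1 hε2.le
    refine outputIsStationary_of_sum_le hobj.smooth hgrad hf' hLm x₁ hε hkT ?_
    intro Ω _ P _ u v hu hv hind
    -- For `ε ≥ L₀` the Lipschitz bound on the gradient suffices at every point, and `√ν ≤ t₁` is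
    -- not available.
    rcases le_or_gt L₀ ε with hεL | hεL
    · calc _ ≤ ∑ k ∈ Finset.Icc (k₀ + 1) T, ε ^ 2 := by
            refine Finset.sum_le_sum fun k _ => ?_
            have := norm_integral_le_of_norm_le_const (μ := P) (C := ε ^ 2)
              (f := fun ω => ‖gradient f (zoslgh rule f' L η γ ν x₁ t₁
                (fun k => u k ω) (fun k => v k ω) k).1‖ ^ 2) (ae_of_all _ fun ω => by
                  rw [Real.norm_of_nonneg (by positivity)]
                  exact pow_le_pow_left₀ (norm_nonneg _) ((hgrad _).trans hεL) 2)
            exact (le_abs_self _).trans (this.trans (by simp))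
        _ = _ := by
            rw [Finset.sum_const, Nat.card_Icc, nsmul_eq_mul, Nat.add_sub_add_right,
              Nat.cast_sub hkT.le]
    · have hν1 : ν * d ^ 3 ≤ min (1 / (8 * (D * E))) (t₁ ^ 2 / L₀ ^ 2) * ε ^ 2 :=
        (le_div_iff₀ (by positivity)).1 hνc
      have hνt : Real.sqrt ν ≤ t₁ := by
        refine Real.sqrt_le_iff.2 ⟨ht₁.le, ?_⟩
        calc ν ≤ ν * d ^ 3 := le_mul_of_one_le_right hν0 (one_le_pow₀ hd')
          _ ≤ (t₁ ^ 2 / L₀ ^ 2) * L₀ ^ 2 := by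
              refine hν1.trans ?_
              gcongr
              exact min_le_right _ _
          _ = t₁ ^ 2 := by field_simp
      have hν2 : D * d * (T * (E * (d ^ 2 * ν))) ≤ T * ε ^ 2 / 8 := by
        calc D * d * (T * (E * (d ^ 2 * ν))) = T * (D * E) * (ν * d ^ 3) := by ring
          _ ≤ T * (D * E) * (1 / (8 * (D * E)) * ε ^ 2) := by
              refine mul_le_mul_of_nonneg_left (hν1.trans ?_) (by positivity)
              gcongr
              exact min_le_left _ _
          _ = _ := by field_simp
      refine (sum_Icc_le_sum_range (fun k => integral_nonneg fun ω => by positivity) k₀ T).trans ?_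
      refine (H hεL hνt Ω P u v hu hv hind).trans ?_
      -- With `N ≤ T ε² / 4`, noise at most `T ε² / 8` and `k₀ ε² ≤ T ε² / 2`, the total stays below
      -- `T ε²`.
      have hT0 : 0 ≤ T * ε ^ 2 := by positivity
      rw [sub_mul]
      linarith
  refine ⟨fun Δ hΔ T hT => ?_, fun M ω hM _ _ T hT => ?_⟩
  · refine key T ((d : ℝ) ^ 3 * (D * (|Δ| + C * q))) (by positivity) ?_ ?_
    · have h1 : (4 * (D * (|Δ| + C * q)) + 2 * |A| + 1) * (d ^ 3 / ε ^ 2) * ε ^ 2 ≤ T * ε ^ 2 := by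
        gcongr
      have h2 : |A| * (d / ε ^ 2) * ε ^ 2 ≤ |A| * d ^ 3 := by
        rw [mul_assoc, div_mul_cancel₀ _ (by positivity)]
        gcongr
        exact le_self_pow₀ hd' (by norm_num)
      rw [mul_assoc, div_mul_cancel₀ _ (by positivity)] at h1
      have h3 : (d : ℝ) ≤ d ^ 3 := le_self_pow₀ hd' (by norm_num)
      linarith
    · intro _ hνt Ω _ P _ u v hu hv hind
      have h := sum_integral_sq_norm_gradient_le hd hL₁.le hℓ hobj.smooth hf' hν hB hB' hgrad
        (fun x => hobj.optimal_value.1 (Set.mem_range_self x)) hLm hL hrule hγ hγγ hγbar ht₁ hνt x₁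
        hu hv hind 0 T (η := η) (Δ := |Δ|) (fun ω => by
          simp only [zoslgh]
          exact hΔ.trans (le_abs_self Δ))
      simp only [zero_add, mul_zero, pow_zero, one_mul] at h
      refine h.trans ?_
      rw [mul_add (640 * (L₁ + 2) * (d : ℝ))]
      refine add_le_add_left ?_ _
      have h1 : D * d * |Δ| ≤ D * d ^ 3 * |Δ| := by
        gcongr
        exact le_self_pow₀ hd' (by norm_num)
      calc D * d * (|Δ| + C * (d ^ 2 * q)) = D * d * |Δ| + d ^ 3 * D * (C * q) := by ring
        _ ≤ _ := by linarith
  · refine key T (d * (K * L₀ ^ 2 + D * (|M| + C * q))) (by positivity) ?_ ?_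
    · have h1 : (4 * (K * L₀ ^ 2 + D * (|M| + C * q)) + 2 * |A| + 1) * (d / ε ^ 2) * ε ^ 2 ≤
          T * ε ^ 2 := by gcongr
      rw [mul_assoc, div_mul_cancel₀ _ (by positivity)] at h1
      rw [mul_assoc |A|, div_mul_cancel₀ _ (by positivity)]
      linarith
    · intro _ hνt Ω _ P _ u v hu hv hind
      have h := sum_integral_sq_norm_gradient_le hd hL₁.le hℓ hobj.smooth hf' hν hB hB' hgrad
        (fun x => hobj.optimal_value.1 (Set.mem_range_self x)) hLm hL hrule hγ hγγ hγbar ht₁ hνt x₁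
        hu hv hind (K * d) T (η := η) (Δ := |M|) (fun ω => (hM _).trans (le_abs_self M))
      set G : ℕ → ℝ := fun k => ∫ ω, ‖gradient f (zoslgh rule f' L η γ ν x₁ t₁
        (fun k => u k ω) (fun k => v k ω) (k + 1)).1‖ ^ 2 ∂P
      have hG0 : ∀ k, 0 ≤ G k := fun k => integral_nonneg fun ω => by positivity
      have hG1 : ∀ k, G k ≤ L₀ ^ 2 := fun k => by
        have := norm_integral_le_of_norm_le_const (μ := P) (C := L₀ ^ 2)
          (f := fun ω => ‖gradient f (zoslgh rule f' L η γ ν x₁ t₁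
            (fun k => u k ω) (fun k => v k ω) (k + 1)).1‖ ^ 2) (ae_of_all _ fun ω => by
              rw [Real.norm_of_nonneg (by positivity)]
              exact pow_le_pow_left₀ (norm_nonneg _) (hgrad _) 2)
        exact (le_abs_self _).trans (this.trans (by simp))
      have hdK := sq_nat_mul_pow_le_one hγbar0 (hK hγbar0) d
      -- The sum is lengthened by `K d` terms so that exactly `T` remain after the burn-in; no
      -- comparison of `T` with `K d` is needed.
      calc ∑ k ∈ Finset.range T, G k ≤ ∑ k ∈ Finset.range (K * d + T), G k :=
            Finset.sum_le_sum_of_subset_of_nonneg (Finset.range_subset_range.2 (by omega))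
              fun k _ _ => hG0 k
        _ = ∑ k ∈ Finset.range (K * d), G k + ∑ k ∈ Finset.range T, G (K * d + k) :=
            Finset.sum_range_add _ _ _
        _ ≤ ∑ k ∈ Finset.range (K * d), L₀ ^ 2 + D * d * (|M| + C *
              (d ^ 2 * (γbar ^ (2 * (K * d)) * t₁ ^ 2 / (1 - γbar ^ 2))) +
              T * (E * (d ^ 2 * ν))) :=
            add_le_add (Finset.sum_le_sum fun k _ => hG1 k) h
        _ = K * d * L₀ ^ 2 + D * d * (|M| + C * ((d ^ 2 * γbar ^ (2 * (K * d))) * q)) +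
              D * d * (T * (E * (d ^ 2 * ν))) := by
            rw [Finset.sum_const, Finset.card_range, nsmul_eq_mul, hq]
            push_cast
            ring
        _ ≤ K * d * L₀ ^ 2 + D * d * (|M| + C * (1 * q)) + D * d * (T * (E * (d ^ 2 * ν))) := by
            gcongr
        _ = _ := by ring
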